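/- Let $k$ be a perfect field of characteristic $p>0$, let $N=\mathbb{Z}^n$ and $M=\mathrm{Hom}(N,\mathbb{Z})=\mathbb{Z}^n$, and let $\sigma\subset N_{\mathbb{R}}=\mathbb{R}^n$ be a strongly convex, full-dimensional rational polyhedral cone with primitive generators $\vec v_1,\dots,\vec v_r\in N$ (a minimal set of generators of $\sigma$ consisting of primitive lattice vectors). Let $\sigma^\vee=\{\vec u\in M_{\mathbb{R}} : \vec u\cdot\vec v\ge 0 \text{ for all }\vec v\in\sigma\}$, let $S=\sigma^\vee\cap M$, let $R=k[S]$ be the coordinate ring of the associated affine toric variety, $d=\dim R$, and let $\mathfrak m\subset R$ be the homogeneous maximal ideal, generated by the monomials $\chi^{\vec u}$ with $0\neq\vec u\in S$. Let $D$ be an effective torus-invariant Weil $\mathbb{Q}$-divisor on $\mathrm{Spec}\,R$, and let $a_i$ be the coefficient in $D$ of the torus-invariant prime divisor $D_i$ corresponding to $\vec v_i$, i.e. $D_i=\mathbb{V}(\chi^{\vec u} : \vec u\in S,\ \vec u\cdot\vec v_i\neq 0)$. Let $\mathfrak a\subset R$ be a monomial ideal and $t\ge 0$ a real number, with $\mathfrak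 a\neq 0$ if $t=0$. For an integral divisor $E$ put $R(E)=\{f\in\mathrm{Frac}(R) : \mathrm{div} f+E\ge 0\}$. For $e\ge 0$ let $\mathfrak D_e\subset \mathrm{Hom}_R(R^{1/p^e},R)$ be the image, under restriction to $R^{1/p^e}$, of $\mathrm{Hom}_R(R(\lceil (p^e-1)D\rceil)^{1/p^e},R)$, let $\mathfrak D'_e$ be the $R^{1/p^e}$-submodule (for the action by premultiplication) generated by the maps $x\mapsto\phi(a^{1/p^e}x)$ with $\phi\in\mathfrak D_e$ and $a\in\mathfrak a^{\lceil (p^e-1)t\rceil}$, and let $I_e=\{r\in R : \phi(r^{1/p^e})\in\mathfrak m\text{ for all }\phi\in\mathfrak D'_e\}$. The $F$-signature of the triple is $s(R,D,\mathfrak a^t)=\lim_{e\to\infty}\ell_R(R/I_e)/p^{ed}$. Let $P_\sigma^D=\{\vec w\in M_{\mathbb{R}} : 0\le\vec w\cdot\vec v_i<1-a_i\text{ for all }i\}$ and let $\mathrm{Newt}(\mathfrak a)\subset M_{\mathbb{R}}$ be the convex hull of the exponents of the monomials in $\mathfrak a$. Then the limit defining $s(R,D,\mathfrak a^t)$ exists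 and $$s(R,D,\mathfrak a^t)=\mathrm{Vol}\bigl((P_\sigma^D-t\cdot\mathrm{Newt}(\mathfrak a))\cap\sigma^\vee\bigr),$$ where $A-B=\{x-y : x\in A,\ y\in B\}$ and the volume is normalized so that a fundamental parallelepiped of $M$ has volume $1$. -/

import Mathlib

open scoped ENNReal Pointwise TensorProduct WithZero

noncomputable section

namespace FSignature

/-! ### Weil divisors and their modules of sections -/

/-- A Weil `ℚ`-divisor on `Spec R`: a finite formal `ℚ`-linear combination of prime ideals of
height one. -/
structure QDivisor (R : Type*) [CommRing R] where
  /-- The coefficient of each prime divisor (zero on every other ideal). -/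
  coeff : Ideal R →₀ ℚ
  isPrime_of_mem : ∀ P ∈ coeff.support, P.IsPrime
  height_of_mem : ∀ P ∈ coeff.support, P.height = 1

/-- A `ℚ`-divisor is effective if its coefficients are nonnegative. -/
def QDivisor.IsEffective {R : Type*} [CommRing R] (D : QDivisor R) : Prop :=
  ∀ P, 0 ≤ D.coeff P

/-- `v` is the normalized discrete valuation of `Frac R` with valuation ring `R_P`, written
multiplicatively: `v f = exp (-ord_P f)`. If `R` is a normal Noetherian domain and `P` is a prime of
height one, there is exactly one such `v`. -/
def IsOrderAlong {R : Type*} [CommRing R] [IsDomain R] (P : Ideal R)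
    (v : Valuation (FractionRing R) ℤᵐ⁰) : Prop :=
  Function.Surjective v ∧
    ∀ f : FractionRing R, v f ≤ 1 ↔ ∃ a s : R, s ∉ P ∧
      f = algebraMap R (FractionRing R) a / algebraMap R (FractionRing R) s

/-- For an integral Weil divisor `E`, given by its coefficients, the `R`-module
`R(E) = {f ∈ Frac R | div f + E ≥ 0}`: for every prime `P` of height one, `ord_P f ≥ -E P`. -/
def sections {R : Type*} [CommRing R] [IsDomain R] (E : Ideal R → ℤ) :
    Submodule R (FractionRing R) where
  carrier := {f | ∀ P : Ideal R, P.IsPrime → P.height = 1 →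
    ∀ v : Valuation (FractionRing R) ℤᵐ⁰, IsOrderAlong P v → v f ≤ WithZero.exp (E P)}
  zero_mem' := by
    intro P _ _ v _
    simp
  add_mem' := by
    intro f g hf hg P hP hP1 v hv
    exact (v.map_add f g).trans (max_le (hf P hP hP1 v hv) (hg P hP hP1 v hv))
  smul_mem' := by
    intro r f hf P hP hP1 v hv
    have h1 : v (algebraMap R (FractionRing R) r) ≤ 1 :=
      (hv.2 _).2 ⟨r, 1, fun h => hP.ne_top ((Ideal.eq_top_iff_one P).2 h), by simp⟩
    rw [Algebra.smul_def, map_mul]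
    exact (mul_le_mul' h1 (hf P hP hP1 v hv)).trans (by rw [one_mul])

/-! ### The `F`-signature of a triple -/

/-- `Hom_R(F^e_* W, R)` for `q = p ^ e`: additive maps `φ : W → R` with `φ (r ^ q • x) = r * φ x`. -/
def frobeniusHom (R : Type*) [CommRing R] (W : Type*) [AddCommGroup W] [Module R W] (q : ℕ) :
    AddSubgroup (W →+ R) where
  carrier := {φ | ∀ (r : R) (x : W), φ (r ^ q • x) = r * φ x}
  zero_mem' := by
    intro r x
    simp
  add_mem' := by
    intro φ ψ hφ hψ r x
    simp [hφ r x, hψ r x, mul_add]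
  neg_mem' := by
    intro φ hφ r x
    simp [hφ r x]

/-- The coefficients of the integral divisor `⌈(p ^ e - 1) D⌉`. -/
def roundUp {R : Type*} [CommRing R] (p : ℕ) (D : QDivisor R) (e : ℕ) (P : Ideal R) : ℤ :=
  ⌈((p : ℚ) ^ e - 1) * D.coeff P⌉

/-- `𝔇_e = Hom_R(F^e_* R(⌈(p ^ e - 1) D⌉), R)`, viewed inside `Hom_R(F^e_* R, R)` by restriction
along `R ⊆ R(⌈(p ^ e - 1) D⌉)` (for `D` effective). -/
def divisorHom {R : Type*} [CommRing R] [IsDomain R] (p : ℕ) (D : QDivisor R) (e : ℕ) :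
    Set (R →+ R) :=
  {φ | φ ∈ frobeniusHom R R (p ^ e) ∧
    ∃ ψ ∈ frobeniusHom R (sections (roundUp p D e)) (p ^ e),
      ∀ (r : R) (hr : algebraMap R (FractionRing R) r ∈ sections (roundUp p D e)),
        φ r = ψ ⟨algebraMap R (FractionRing R) r, hr⟩}

/-- `𝔇'_e = 𝔇_e · F^e_* (𝔞 ^ ⌈(p ^ e - 1) t⌉)`: the `F^e_* R`-submodule (for the action by
premultiplication) generated by the maps `x ↦ φ (a * x)` with `φ ∈ 𝔇_e` and
`a ∈ 𝔞 ^ ⌈(p ^ e - 1) t⌉`. -/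
def tripleHom {R : Type*} [CommRing R] [IsDomain R] (p : ℕ) (D : QDivisor R) (𝔞 : Ideal R)
    (t : ℝ) (e : ℕ) : AddSubgroup (R →+ R) :=
  AddSubgroup.closure {χ | ∃ s : R, ∃ φ ∈ divisorHom p D e,
    ∃ a ∈ 𝔞 ^ ⌈((p : ℝ) ^ e - 1) * t⌉₊,
      χ = (φ.comp (AddMonoidHom.mulLeft a)).comp (AddMonoidHom.mulLeft s)}

theorem tripleHom_comp_mulLeft_mem {R : Type*} [CommRing R] [IsDomain R] (p : ℕ) (D : QDivisor R)
    (𝔞 : Ideal R) (t : ℝ) (e : ℕ) (c : R) {φ : R →+ R} (hφ : φ ∈ tripleHom p D 𝔞 t e) :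
    φ.comp (AddMonoidHom.mulLeft c) ∈ tripleHom p D 𝔞 t e := by
  unfold tripleHom at hφ
  induction hφ using AddSubgroup.closure_induction with
  | mem χ h =>
    obtain ⟨s, φ, hφ, a, ha, rfl⟩ := h
    refine AddSubgroup.subset_closure ⟨s * c, φ, hφ, a, ha, ?_⟩
    ext x
    simp [mul_assoc]
  | zero => simp [zero_mem]
  | add x y _ _ hx hy =>
    rw [AddMonoidHom.add_comp]
    exact add_mem hx hy
  | neg x _ hx =>
    have h : (-x).comp (AddMonoidHom.mulLeft c) = -(x.comp (AddMonoidHom.mulLeft c)) := by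
      ext y
      simp
    rw [h]
    exact neg_mem hx

/-- `I_e = {r ∈ R | φ (F^e_* r) ∈ 𝔪 for all φ ∈ 𝔇'_e}`. -/
def tripleIdeal {R : Type*} [CommRing R] [IsDomain R] (p : ℕ) (𝔪 : Ideal R) (D : QDivisor R)
    (𝔞 : Ideal R) (t : ℝ) (e : ℕ) : Ideal R where
  carrier := {r | ∀ φ ∈ tripleHom p D 𝔞 t e, φ r ∈ 𝔪}
  zero_mem' := by
    intro φ _
    simp
  add_mem' := by
    intro a b ha hb φ hφ
    rw [map_add]
    exact add_mem (ha φ hφ) (hb φ hφ)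
  smul_mem' := by
    intro c r hr φ hφ
    exact hr _ (tripleHom_comp_mulLeft_mem p D 𝔞 t e c hφ)

/-- The `F`-signature `s(R, D, 𝔞 ^ t)` of a normal domain `R` of characteristic `p` that is local
or `ℕ`-graded with (homogeneous) maximal ideal `𝔪` exists and equals `s`:
`ℓ(R / I_e) / p ^ (e * d)` tends to `s`, where `d = dim R`. -/
def HasFSignature {R : Type*} [CommRing R] [IsDomain R] (p : ℕ) (𝔪 : Ideal R) (D : QDivisor R)
    (𝔞 : Ideal R) (t : ℝ) (s : ℝ≥0∞) : Prop :=
  ∃ d : ℕ, ringKrullDim R = d ∧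
    Filter.Tendsto
      (fun e : ℕ => ((Module.length R (R ⧸ tripleIdeal p 𝔪 D 𝔞 t e) : ℕ∞) : ℝ≥0∞) /
        (p : ℝ≥0∞) ^ (e * d))
      Filter.atTop (nhds s)

/-! ### Affine toric varieties -/

/-- The inclusion of the lattice `ℤ^n` in `ℝ^n`. -/
def toReal {n : ℕ} (u : Fin n → ℤ) : Fin n → ℝ := fun i => (u i : ℝ)

/-- The family `v` consists of the primitive generators of the cone `σ`: it is a minimal set of
generators of `σ`, and each `v i` is a primitive lattice vector. -/
structure IsPrimitiveGenerators {n r : ℕ} (σ : PointedCone ℝ (Fin n → ℝ))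
    (v : Fin r → Fin n → ℤ) : Prop where
  hull_eq : PointedCone.hull ℝ (Set.range fun i => toReal (v i)) = σ
  minimal : ∀ i, toReal (v i) ∉ PointedCone.hull ℝ ((fun j => toReal (v j)) '' {j | j ≠ i})
  primitive : ∀ i (c : ℤ) (w : Fin n → ℤ), v i = c • w → IsUnit c

/-- The dual cone `σ^∨ ⊆ M_ℝ`. -/
def dualCone {n : ℕ} (σ : PointedCone ℝ (Fin n → ℝ)) : PointedCone ℝ (Fin n → ℝ) :=
  PointedCone.dual (dotProductBilin ℝ ℝ) (σ : Set (Fin n → ℝ))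

/-- The semigroup `S = σ^∨ ∩ M`. -/
def charMonoid {n : ℕ} (σ : PointedCone ℝ (Fin n → ℝ)) : AddSubmonoid (Fin n → ℤ) where
  carrier := {u | toReal u ∈ dualCone σ}
  zero_mem' := by
    have h : toReal (0 : Fin n → ℤ) = 0 := by
      ext i
      simp [toReal]
    simp only [Set.mem_ofPred_eq, h]
    exact zero_mem _
  add_mem' := by
    intro a b ha hb
    have h : toReal (a + b) = toReal a + toReal b := by
      ext i
      simp [toReal]
    simp only [Set.mem_ofPred_eq, h] at *
    exact add_mem ha hb

/-- The coordinate ring `k[S]` of the affine toric variety of `σ`. -/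
abbrev ToricRing (k : Type*) [Field k] {n : ℕ} (σ : PointedCone ℝ (Fin n → ℝ)) : Type _ :=
  AddMonoidAlgebra k (charMonoid σ)

instance toricRing_isDomain (k : Type*) [Field k] {n : ℕ} (σ : PointedCone ℝ (Fin n → ℝ)) :
    IsDomain (ToricRing k σ) := by
  have hinj : Function.Injective
      (AddMonoidAlgebra.mapDomainAlgHom k k (charMonoid σ).subtype) :=
    AddMonoidAlgebra.mapDomain_injective Subtype.val_injective
  have : IsDomain (AddMonoidAlgebra k (Fin n → ℤ)) := NoZeroDivisors.to_isDomain _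
  exact hinj.isDomain

/-- The monomial `χ^u`. -/
def monomial (k : Type*) [Field k] {n : ℕ} {σ : PointedCone ℝ (Fin n → ℝ)} (u : charMonoid σ) :
    ToricRing k σ :=
  AddMonoidAlgebra.single u 1

/-- The homogeneous maximal ideal, generated by the monomials `χ^u` with `u ≠ 0`. -/
def maxIdeal (k : Type*) [Field k] {n : ℕ} (σ : PointedCone ℝ (Fin n → ℝ)) :
    Ideal (ToricRing k σ) :=
  Ideal.span (monomial k '' {u | u ≠ 0})

/-- A monomial ideal is an ideal generated by monomials. -/
def IsMonomialIdeal {k : Type*} [Field k] {n : ℕ} {σ : PointedCone ℝ (Fin n → ℝ)}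
    (𝔞 : Ideal (ToricRing k σ)) : Prop :=
  ∃ T : Set (charMonoid σ), 𝔞 = Ideal.span (monomial k '' T)

/-- The action of the torus `Spec k[M]` on `Spec k[S]`, as the map of rings
`k[S] → k[S] ⊗ k[M]`, `χ^u ↦ χ^u ⊗ χ^u`. -/
def torusCoaction (k : Type*) [Field k] {n : ℕ} (σ : PointedCone ℝ (Fin n → ℝ)) :
    ToricRing k σ →ₐ[k] ToricRing k σ ⊗[k] AddMonoidAlgebra k (Fin n → ℤ) :=
  AddMonoidAlgebra.lift k _ (charMonoid σ)
    { toFun := fun u => monomial k u.toAdd ⊗ₜ AddMonoidAlgebra.single (u.toAdd : Fin n → ℤ) 1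
      map_one' := rfl
      map_mul' := by
        intro a b
        simp [monomial, AddMonoidAlgebra.single_mul_single] }

/-- The closed subscheme `V(I)` is invariant under the torus: the action restricted to
`V(I) × T` factors through `V(I)`. -/
def IsTorusInvariantIdeal {k : Type*} [Field k] {n : ℕ} {σ : PointedCone ℝ (Fin n → ℝ)}
    (I : Ideal (ToricRing k σ)) : Prop :=
  I.map (torusCoaction k σ) ≤
    I.map (Algebra.TensorProduct.includeLeft :
      ToricRing k σ →ₐ[k] ToricRing k σ ⊗[k] AddMonoidAlgebra k (Fin n → ℤ))

/-- A `ℚ`-divisor is torus-invariant if it is a combination of torus-invariant prime divisors. -/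
def IsTorusInvariant {k : Type*} [Field k] {n : ℕ} {σ : PointedCone ℝ (Fin n → ℝ)}
    (D : QDivisor (ToricRing k σ)) : Prop :=
  ∀ P ∈ D.coeff.support, IsTorusInvariantIdeal P

/-- The ideal of the torus-invariant prime divisor corresponding to the primitive generator `v`:
it is generated by the monomials `χ^u` with `u · v ≠ 0`. -/
def rayIdeal (k : Type*) [Field k] {n : ℕ} (σ : PointedCone ℝ (Fin n → ℝ)) (v : Fin n → ℤ) :
    Ideal (ToricRing k σ) :=
  Ideal.span (monomial k '' {u | (u : Fin n → ℤ) ⬝ᵥ v ≠ 0})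

/-- The polytope `P_σ^D = {w | 0 ≤ w · v_i < 1 - a_i for all i}`, where `a_i` is the coefficient in
`D` of the prime divisor corresponding to `v_i`. -/
def divisorPolytope {k : Type*} [Field k] {n r : ℕ} {σ : PointedCone ℝ (Fin n → ℝ)}
    (v : Fin r → Fin n → ℤ) (D : QDivisor (ToricRing k σ)) : Set (Fin n → ℝ) :=
  {w | ∀ i, 0 ≤ w ⬝ᵥ toReal (v i) ∧
    w ⬝ᵥ toReal (v i) < 1 - ((D.coeff (rayIdeal k σ (v i)) : ℚ) : ℝ)}

/-- The Newton polyhedron of `𝔞`: the convex hull of the exponents of the monomials in `𝔞`. -/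
def newtonPolyhedron {k : Type*} [Field k] {n : ℕ} {σ : PointedCone ℝ (Fin n → ℝ)}
    (𝔞 : Ideal (ToricRing k σ)) : Set (Fin n → ℝ) :=
  convexHull ℝ ((fun u : charMonoid σ => toReal (u : Fin n → ℤ)) '' {u | monomial k u ∈ 𝔞})

/-- The polytope `(P_σ^D - t · Newt 𝔞) ∩ σ^∨`, with the Minkowski difference
`A - B = {x - y | x ∈ A, y ∈ B}`. -/
def triplePolytope {k : Type*} [Field k] {n r : ℕ} {σ : PointedCone ℝ (Fin n → ℝ)}
    (v : Fin r → Fin n → ℤ) (D : QDivisor (ToricRing k σ)) (𝔞 : Ideal (ToricRing k σ)) (t : ℝ) :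
    Set (Fin n → ℝ) :=
  (divisorPolytope v D - t • newtonPolyhedron 𝔞) ∩ (dualCone σ : Set (Fin n → ℝ))

end FSignature

end

noncomputable section

namespace FSignature

/-! Everything is monomial, so `I_e` is spanned by the monomials it contains, and its colength
counts the others. These turn out to be lattice points of a dilated polytope.

Write `q = p ^ e` and `E = ⌈(q - 1) D⌉`. Sections of `R(E)` are the Laurent polynomials whose
exponents satisfy `u · v_i ≥ -E_i`: `k[M]` is a UFD, and a pole inside the torus is impossible
because `E` is supported on the boundary. If `x · v_i < q - E_i` for all `i`, taking `q`-th roots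
after dividing by `χ^x` defines a map in `𝔇_e` that sends `χ^x` to `1`. If the inequality fails for
some `i`, then `χ^(x + q m)` is still a section for a suitable `m` with `m · v_i = -1`, and
linearity forces the constant term of the image of `χ^x` to vanish. Hence `χ^u ∉ I_e` exactly when
some monomial `χ^a` in the relevant power of `𝔞` satisfies `(u + a) · v_i < q - E_i` for all `i`
(`FacetPresentation.tripleIdeal_eq`).

For integers `z`, the condition `z < q - E_i` is equivalent to `z ≤ (q - 1)(1 - a_i)`
(`lt_sub_roundUp_iff`). The exponents `u` therefore all lie in the `(q - 1)`-fold dilation of the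
closed version of the polytope. Conversely, for each of a family of inner polytopes exhausting the
open version, the lattice points of its `(q - 1)`-fold dilation all occur once `e` is large. All
these sets are bounded and convex, so lattice points compute their volumes; the open and closed
versions have equal volume, and replacing `(q - 1)^n` by `q^n` does not affect the limit. -/

/-! ### Convex geometry of the cone: interior and facet lattice vectors. -/

theorem toReal_dotProduct {n : ℕ} (u w : Fin n → ℤ) :
    toReal u ⬝ᵥ toReal w = ((u ⬝ᵥ w : ℤ) : ℝ) := by
  simp [toReal, dotProduct]

theorem mem_dualCone_iff {n r : ℕ} {σ : PointedCone ℝ (Fin n → ℝ)} {v : Fin r → Fin n → ℤ}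
    (hv : PointedCone.hull ℝ (Set.range fun i => toReal (v i)) = σ) (w : Fin n → ℝ) :
    w ∈ dualCone σ ↔ ∀ i, 0 ≤ w ⬝ᵥ toReal (v i) := by
  subst hv
  unfold dualCone
  rw [PointedCone.dual_hull, PointedCone.mem_dual]
  simp [dotProduct_comm]

/-- The lattice directions `v` present `S = σ^∨ ∩ M` irredundantly as an intersection of half
spaces: `S` has an interior point, and each `v i` is primitive and cuts out a facet. -/
structure FacetPresentation {n r : ℕ} (σ : PointedCone ℝ (Fin n → ℝ))
    (v : Fin r → Fin n → ℤ) : Prop where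
  mem_charMonoid_iff : ∀ u, u ∈ charMonoid σ ↔ ∀ i, 0 ≤ u ⬝ᵥ v i
  exists_interior : ∃ w : Fin n → ℤ, ∀ i, 0 < w ⬝ᵥ v i
  exists_facet : ∀ i, ∃ w : Fin n → ℤ, w ⬝ᵥ v i = 0 ∧ ∀ j, j ≠ i → 0 < w ⬝ᵥ v j
  exists_eq_one : ∀ i, ∃ w : Fin n → ℤ, w ⬝ᵥ v i = 1

/-- If no convex combination of finitely many vectors lies in a subspace, then some linear form
vanishes on the subspace and is positive on the vectors. -/
theorem exists_dotProduct_pos_of_disjoint {n : ℕ} {s : Set (Fin n → ℝ)} (hs : s.Finite)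
    (W : Submodule ℝ (Fin n → ℝ)) (h : Disjoint (convexHull ℝ s) (W : Set (Fin n → ℝ))) :
    ∃ u : Fin n → ℝ, (∀ w ∈ W, u ⬝ᵥ w = 0) ∧ ∀ x ∈ s, 0 < u ⬝ᵥ x := by
  obtain ⟨f, a, b, hf, hab, hfb⟩ := geometric_hahn_banach_compact_closed
    (convex_convexHull ℝ s) (hs.isCompact_convexHull (𝕜 := ℝ))
    W.convex W.closed_of_finiteDimensional h
  have hrep : ∀ x, f x = (fun i => f (Pi.single i 1)) ⬝ᵥ x := by
    intro x
    conv_lhs => rw [← Finset.univ_sum_single x]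
    rw [map_sum]
    refine Finset.sum_congr rfl fun i _ => ?_
    have : (Pi.single i (x i) : Fin n → ℝ) = x i • Pi.single i 1 := by
      rw [← Pi.single_smul, smul_eq_mul, mul_one]
    rw [this, map_smul, smul_eq_mul, mul_comm]
  -- A linear form bounded below on a subspace vanishes there, since otherwise scaling reaches any
  -- value.
  have hW : ∀ w ∈ W, f w = 0 := by
    intro w hw
    by_contra hne
    have := hfb (((b - 1) / f w) • w) (W.smul_mem _ hw)
    rw [map_smul, smul_eq_mul, div_mul_cancel₀ _ hne] at this
    linarith
  have hb : b < 0 := by simpa using hfb 0 W.zero_mem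
  refine ⟨-fun i => f (Pi.single i 1), fun w hw => ?_, fun x hx => ?_⟩
  · rw [neg_dotProduct, ← hrep, hW w hw, neg_zero]
  · rw [neg_dotProduct, ← hrep]
    linarith [hf x (subset_convexHull ℝ s hx)]

/-- Rounding a large multiple of a real vector to a lattice vector changes the pairing with
finitely many fixed lattice vectors by a bounded amount. -/
theorem exists_round {n r : ℕ} (v : Fin r → Fin n → ℤ) :
    ∃ C : ℝ, 0 ≤ C ∧ ∀ u : Fin n → ℝ, ∃ z : Fin n → ℤ,
      ∀ i, |((z ⬝ᵥ v i : ℤ) : ℝ) - u ⬝ᵥ toReal (v i)| ≤ C := by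
  refine ⟨∑ i, ∑ j, |(v i j : ℝ)|, by positivity, fun u => ⟨fun j => ⌊u j⌋, fun i => ?_⟩⟩
  have h1 : (((fun j => ⌊u j⌋) ⬝ᵥ v i : ℤ) : ℝ) - u ⬝ᵥ toReal (v i) =
      ∑ j, ((⌊u j⌋ : ℝ) - u j) * (v i j : ℝ) := by
    simp [dotProduct, toReal, sub_mul, Finset.sum_sub_distrib]
  rw [h1]
  refine (Finset.abs_sum_le_sum_abs _ _).trans ?_
  refine le_trans (Finset.sum_le_sum fun j _ => ?_)
    (Finset.single_le_sum (f := fun i => ∑ j, |(v i j : ℝ)|)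
      (fun i _ => by positivity) (Finset.mem_univ i))
  rw [abs_mul]
  refine mul_le_of_le_one_left (abs_nonneg _) ?_
  rw [abs_le]
  constructor <;> linarith [Int.floor_le (u j), Int.lt_floor_add_one (u j)]

/-- Bézout: the entries of `v` generate an ideal `(g)`, and `g` divides `v`, so primitivity makes
`g` a unit. -/
theorem exists_dotProduct_eq_one {n : ℕ} (v : Fin n → ℤ)
    (hv : ∀ (c : ℤ) (w : Fin n → ℤ), v = c • w → IsUnit c) :
    ∃ w : Fin n → ℤ, w ⬝ᵥ v = 1 := by
  obtain ⟨g, hg⟩ := (IsPrincipalIdealRing.principal (Ideal.span (Set.range v))).principal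
  change Ideal.span (Set.range v) = Ideal.span {g} at hg
  have hdvd : ∀ i, g ∣ v i := fun i => by
    rw [← Ideal.mem_span_singleton, ← hg]
    exact Ideal.subset_span ⟨i, rfl⟩
  choose w hw using hdvd
  have hu : IsUnit g := hv g w (funext fun i => by simp [hw i])
  have h1 : (1 : ℤ) ∈ Ideal.span (Set.range v) := by
    rw [hg, Ideal.span_singleton_eq_top.2 hu]
    trivial
  obtain ⟨c, hc⟩ := Ideal.mem_span_range_iff_exists_fun.1 h1
  exact ⟨c, hc⟩

/-- A relation `a x + b y = 0` with `a > 0` would make `-x` a nonnegative multiple of `y`, hence an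
element of `σ`. -/
theorem convex_sdiff_zero_of_salient {n : ℕ} {σ : PointedCone ℝ (Fin n → ℝ)}
    (hσ : ∀ x ∈ σ, x ≠ 0 → -x ∉ σ) : Convex ℝ ((σ : Set (Fin n → ℝ)) \ {0}) := by
  rintro x ⟨hx, hx0⟩ y ⟨hy, hy0⟩ a b ha hb hab
  have hmem : ∀ {c : ℝ} {z : Fin n → ℝ}, 0 ≤ c → z ∈ σ → c • z ∈ σ :=
    fun {c z} hc hz => σ.smul_mem hc hz
  refine ⟨σ.add_mem (hmem ha hx) (hmem hb hy), fun h0 => ?_⟩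
  have h0 : a • x + b • y = 0 := h0
  rcases ha.eq_or_lt with rfl | ha
  · have hb1 : b = 1 := by linarith
    subst hb1
    exact hy0 (by simpa using h0)
  · refine hσ x hx hx0 ?_
    have : -x = (b / a) • y := by
      have h2 : a • x = -(b • y) := eq_neg_of_add_eq_zero_left h0
      have h3 : x = a⁻¹ • (a • x) := by rw [smul_smul, inv_mul_cancel₀ ha.ne', one_smul]
      rw [h3, h2, smul_neg, neg_neg, smul_smul]
      congr 1
      ring
    rw [this]
    exact hmem (by positivity) hy

/-- Real interior and facet vectors come from separation: strong convexity keeps the hull of the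
generators away from `0`, and together with minimality keeps the hull of the other generators away
from the line of `v i`. Large multiples are then rounded to lattice vectors. -/
theorem IsPrimitiveGenerators.facetPresentation {n r : ℕ} {σ : PointedCone ℝ (Fin n → ℝ)}
    {v : Fin r → Fin n → ℤ} (hv : IsPrimitiveGenerators σ v)
    (hσ : ∀ x ∈ σ, x ≠ 0 → -x ∉ σ) : FacetPresentation σ v := by
  have hvσ : ∀ i, toReal (v i) ∈ σ := fun i => by
    rw [← hv.hull_eq]
    exact Submodule.subset_span ⟨i, rfl⟩
  have hv0 : ∀ i, toReal (v i) ≠ 0 := fun i h => hv.minimal i (by rw [h]; exact zero_mem _)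
  have hone := fun i => exists_dotProduct_eq_one (v i) (hv.primitive i)
  have hsub : ∀ s : Set (Fin r), convexHull ℝ ((fun j => toReal (v j)) '' s) ⊆
      (σ : Set (Fin n → ℝ)) \ {0} := fun s => by
    refine convexHull_min ?_ (convex_sdiff_zero_of_salient hσ)
    rintro _ ⟨j, -, rfl⟩
    exact ⟨hvσ j, hv0 j⟩
  obtain ⟨C, hC0, hC⟩ := exists_round v
  have hlarge : ∀ (u : Fin n → ℝ) (B : ℝ) (s : Set (Fin r)),
      (∀ j ∈ s, 0 < u ⬝ᵥ toReal (v j)) → ∃ N : ℕ, ∀ j ∈ s, B < N * (u ⬝ᵥ toReal (v j)) := by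
    intro u B s hpos
    have : ∀ j, ∃ N : ℕ, j ∈ s → B < N * (u ⬝ᵥ toReal (v j)) := fun j => by
      by_cases hj : j ∈ s
      · obtain ⟨N, hN⟩ := exists_nat_gt (B / (u ⬝ᵥ toReal (v j)))
        exact ⟨N, fun _ => (div_lt_iff₀ (hpos j hj)).1 hN⟩
      · exact ⟨0, fun h => absurd h hj⟩
    choose N hN using this
    refine ⟨∑ j, N j, fun j hj => (hN j hj).trans_le ?_⟩
    refine mul_le_mul_of_nonneg_right ?_ (hpos j hj).le
    exact_mod_cast Finset.single_le_sum (f := N) (fun _ _ => Nat.zero_le _) (Finset.mem_univ j)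
  refine ⟨fun u => ?_, ?_, fun i => ?_, hone⟩
  · change toReal u ∈ dualCone σ ↔ _
    rw [mem_dualCone_iff hv.hull_eq]
    simp [toReal_dotProduct]
  · obtain ⟨u, -, hu⟩ := exists_dotProduct_pos_of_disjoint
      ((Set.finite_univ (α := Fin r)).image fun j => toReal (v j)) ⊥
      (Set.disjoint_left.2 fun x hx h0 => (hsub _ hx).2 h0)
    obtain ⟨N, hN⟩ := hlarge u C Set.univ fun j _ => hu _ ⟨j, trivial, rfl⟩
    obtain ⟨z, hz⟩ := hC ((N : ℝ) • u)
    refine ⟨z, fun i => ?_⟩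
    have h1 := hz i
    rw [smul_dotProduct, smul_eq_mul, abs_le] at h1
    have := hN i trivial
    exact_mod_cast (by linarith : (0 : ℝ) < ((z ⬝ᵥ v i : ℤ) : ℝ))
  · obtain ⟨u, hu0, hu⟩ := exists_dotProduct_pos_of_disjoint
      (({j | j ≠ i} : Set (Fin r)).toFinite.image fun j => toReal (v j))
      (Submodule.span ℝ {toReal (v i)}) <| by
        refine Set.disjoint_left.2 fun x hx hxi => ?_
        obtain ⟨c, rfl⟩ := Submodule.mem_span_singleton.1 hxi
        -- Nonpositive multiples of `v i` are excluded by strong convexity, positive ones by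
        -- minimality of the generators.
        rcases le_or_gt c 0 with hc | hc
        · refine hσ _ (hsub _ hx).1 (hsub _ hx).2 ?_
          rw [← neg_smul]
          exact σ.smul_mem (by linarith) (hvσ i)
        · refine hv.minimal i ?_
          have h1 : c • toReal (v i) ∈
              PointedCone.hull ℝ ((fun j => toReal (v j)) '' {j | j ≠ i}) :=
            convexHull_min Submodule.subset_span (PointedCone.convex _) hx
          have h2 := Submodule.smul_mem _ (⟨c⁻¹, by positivity⟩ : {c : ℝ // 0 ≤ c}) h1
          have h3 : (⟨c⁻¹, by positivity⟩ : {c : ℝ // 0 ≤ c}) • c • toReal (v i) =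
              toReal (v i) := by
            change c⁻¹ • c • toReal (v i) = _
            rw [smul_smul, inv_mul_cancel₀ hc.ne', one_smul]
          rwa [h3] at h2
    obtain ⟨m, hm⟩ := hone i
    have hui : u ⬝ᵥ toReal (v i) = 0 := hu0 _ (Submodule.mem_span_singleton_self _)
    -- Rounding perturbs `z · v i` away from zero by at most `C`. Subtracting that multiple of `m`
    -- restores zero exactly, so the margin covers the rounding error `C` and the effect of this
    -- correction on the other pairings.
    obtain ⟨N, hN⟩ := hlarge u (C + C * ∑ j, |((m ⬝ᵥ v j : ℤ) : ℝ)|) {j | j ≠ i}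
      fun j hj => hu _ ⟨j, hj, rfl⟩
    obtain ⟨z, hz⟩ := hC ((N : ℝ) • u)
    refine ⟨z - (z ⬝ᵥ v i) • m, ?_, fun j hj => ?_⟩
    · rw [sub_dotProduct, smul_dotProduct, hm, smul_eq_mul, mul_one, sub_self]
    · have h1 := hz j
      have h2 := hz i
      rw [smul_dotProduct, smul_eq_mul] at h1 h2
      rw [hui, mul_zero, sub_zero] at h2
      have h3 := hN j hj
      have h4 : |((z ⬝ᵥ v i : ℤ) : ℝ) * ((m ⬝ᵥ v j : ℤ) : ℝ)| ≤
          C * ∑ j, |((m ⬝ᵥ v j : ℤ) : ℝ)| := by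
        rw [abs_mul]
        refine mul_le_mul h2 ?_ (abs_nonneg _) hC0
        exact Finset.single_le_sum (f := fun j => |((m ⬝ᵥ v j : ℤ) : ℝ)|)
          (fun _ _ => abs_nonneg _) (Finset.mem_univ j)
      rw [abs_le] at h1 h4
      have : (0 : ℝ) < (((z - (z ⬝ᵥ v i) • m) ⬝ᵥ v j : ℤ) : ℝ) := by
        rw [sub_dotProduct, smul_dotProduct, smul_eq_mul]
        push_cast
        linarith
      exact_mod_cast this

/-! ### Valuations along primes of height one. -/

section Valuation

variable {R : Type*} [CommRing R] [IsDomain R]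

/-- The multiplicative valuation `a ↦ exp (-ord a)` attached to an order function on the nonzero
elements of a domain. -/
def valuationOfOrder {A : Type*} [CommRing A] [IsDomain A] (ord : A → ℤ) (h1 : ord 1 = 0)
    (hmul : ∀ a b, a ≠ 0 → b ≠ 0 → ord (a * b) = ord a + ord b)
    (hadd : ∀ a b, a ≠ 0 → b ≠ 0 → a + b ≠ 0 → min (ord a) (ord b) ≤ ord (a + b)) :
    Valuation A ℤᵐ⁰ := by
  classical exact
  { toFun := fun a => if a = 0 then 0 else WithZero.exp (-ord a)
    map_zero' := by simp
    map_one' := by simp [h1]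
    map_mul' := by
      intro a b
      by_cases ha : a = 0
      · simp [ha]
      by_cases hb : b = 0
      · simp [hb]
      rw [if_neg ha, if_neg hb, if_neg (mul_ne_zero ha hb), hmul a b ha hb, neg_add,
        WithZero.exp_add]
    map_add_le_max' := by
      intro a b
      by_cases ha : a = 0
      · simp [ha]
      by_cases hb : b = 0
      · simp [hb]
      by_cases hab : a + b = 0
      · simp [hab]
      rw [if_neg ha, if_neg hb, if_neg hab]
      have := hadd a b ha hb hab
      rw [le_max_iff, WithZero.exp_le_exp, WithZero.exp_le_exp]
      rcases min_le_iff.1 this with h | h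
      · left; linarith
      · right; linarith }

theorem valuationOfOrder_apply {A : Type*} [CommRing A] [IsDomain A] {ord : A → ℤ} {h1 hmul hadd}
    {a : A} (ha : a ≠ 0) :
    valuationOfOrder ord h1 hmul hadd a = WithZero.exp (-ord a) := by
  classical exact if_neg ha

theorem valuationOfOrder_ne_zero {A : Type*} [CommRing A] [IsDomain A] {ord : A → ℤ} {h1 hmul hadd}
    {a : A} (ha : a ≠ 0) :
    valuationOfOrder ord h1 hmul hadd a ≠ 0 := by
  rw [valuationOfOrder_apply ha]
  exact WithZero.exp_ne_zero

/-- A valuation on a domain with trivial support extends to any fraction field. -/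
theorem exists_valuation_extension {A K : Type*} [CommRing A] [IsDomain A] [Field K]
    [Algebra A K] [IsFractionRing A K] (v : Valuation A ℤᵐ⁰) (hv : ∀ a, a ≠ 0 → v a ≠ 0) :
    ∃ w : Valuation K ℤᵐ⁰, ∀ a, w (algebraMap A K a) = v a := by
  have hS : nonZeroDivisors A ≤ v.supp.primeCompl := fun a ha h =>
    hv a (nonZeroDivisors.ne_zero ha) ((Valuation.mem_supp_iff v a).1 h)
  exact ⟨v.extendToLocalization hS K, fun a => v.extendToLocalization_apply_map_apply hS K a⟩

variable {P : Ideal R} {v w : Valuation (FractionRing R) ℤᵐ⁰}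

theorem IsOrderAlong.map_le_one (h : IsOrderAlong P v) (hP : P.IsPrime) (a : R) :
    v (algebraMap R (FractionRing R) a) ≤ 1 :=
  (h.2 _).2 ⟨a, 1, fun h1 => hP.ne_top ((Ideal.eq_top_iff_one P).2 h1), by simp⟩

theorem IsOrderAlong.map_eq_one (h : IsOrderAlong P v) (hP : P.IsPrime) {a : R} (ha : a ∉ P) :
    v (algebraMap R (FractionRing R) a) = 1 := by
  refine le_antisymm (h.map_le_one hP a) ?_
  have h1 : v ((algebraMap R (FractionRing R) a)⁻¹) ≤ 1 :=
    (h.2 _).2 ⟨1, a, ha, by simp⟩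
  have ha0 : a ≠ 0 := fun h0 => ha (h0 ▸ P.zero_mem)
  have hva : v (algebraMap R (FractionRing R) a) ≠ 0 := by
    rw [Valuation.ne_zero_iff]
    simpa using ha0
  rw [map_inv₀] at h1
  exact (inv_le_one₀ (zero_lt_iff.2 hva)).1 h1

/-- If `v a = 1`, then `1 / a = b / s` with `s ∉ P`, whence `s = a b ∈ P`, a contradiction. -/
theorem IsOrderAlong.map_lt_one (h : IsOrderAlong P v) (hP : P.IsPrime) {a : R} (ha : a ∈ P) :
    v (algebraMap R (FractionRing R) a) < 1 := by
  refine lt_of_le_of_ne (h.map_le_one hP a) fun h1 => ?_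
  by_cases ha0 : a = 0
  · simp [ha0] at h1
  have h2 : v ((algebraMap R (FractionRing R) a)⁻¹) ≤ 1 := by rw [map_inv₀, h1, inv_one]
  obtain ⟨b, s, hs, hbs⟩ := (h.2 _).1 h2
  have hs0 : s ≠ 0 := fun h0 => hs (h0 ▸ P.zero_mem)
  have ha0' : algebraMap R (FractionRing R) a ≠ 0 := by simpa using ha0
  have hs0' : algebraMap R (FractionRing R) s ≠ 0 := by simpa using hs0
  rw [eq_div_iff hs0', inv_mul_eq_iff_eq_mul₀ ha0', ← map_mul] at hbs
  have := IsFractionRing.injective R (FractionRing R) hbs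
  exact hs (this ▸ P.mul_mem_right _ ha)

theorem exists_pow_le_of_lt_one {x y : ℤᵐ⁰} (hx : x < 1) (hy : y ≠ 0) : ∃ N : ℕ, x ^ N ≤ y := by
  by_cases hx0 : x = 0
  · exact ⟨1, by simp [hx0]⟩
  rw [← WithZero.exp_log hx0, ← WithZero.exp_zero, WithZero.exp_lt_exp] at hx
  refine ⟨(-WithZero.log y).toNat, ?_⟩
  rw [← WithZero.exp_log hx0, ← WithZero.exp_log hy, ← WithZero.exp_nsmul, WithZero.exp_le_exp,
    WithZero.log_exp, nsmul_eq_mul]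
  have := Int.self_le_toNat (-WithZero.log y)
  nlinarith [Int.natCast_nonneg (-WithZero.log y).toNat]

/-- Suppose `Q ⊊ P` is prime, with `0 ≠ b ∈ Q`. For `a ∈ P` a high power `a ^ N / b` has value at
most one, so `a ^ N * s ∈ (b) ⊆ Q` for some `s ∉ P`; hence `a ∈ Q`. Thus `P ⊆ Q`, a contradiction.
-/
theorem IsOrderAlong.height_eq_one (h : IsOrderAlong P v) (hP : P.IsPrime) : P.height = 1 := by
  have hbot : P ≠ ⊥ := by
    rintro rfl
    obtain ⟨f, hf⟩ := h.1 (WithZero.exp 1)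
    have hle : ∀ f : FractionRing R, v f ≤ 1 := fun f => by
      obtain ⟨a, b, hb, rfl⟩ := IsFractionRing.div_surjective (A := R) f
      exact (h.2 _).2 ⟨a, b, fun h0 => nonZeroDivisors.ne_zero hb (by simpa using h0), rfl⟩
    have := hle f
    rw [hf, ← WithZero.exp_zero, WithZero.exp_le_exp] at this
    omega
  refine le_antisymm ?_ ?_
  · have := (Ideal.height_le_iff (p := P) (n := 1)).2 fun Q hQ hQP => by
      have hQ0 : Q = ⊥ := by
        by_contra hQ0
        obtain ⟨b, hbQ, hb0⟩ := Submodule.exists_mem_ne_zero_of_ne_bot hQ0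
        refine hQP.not_ge fun a ha => ?_
        have hb0' : algebraMap R (FractionRing R) b ≠ 0 := by simpa using hb0
        obtain ⟨N, hN⟩ := exists_pow_le_of_lt_one (h.map_lt_one hP ha)
          ((Valuation.ne_zero_iff v).2 hb0')
        have h1 : v ((algebraMap R (FractionRing R) a) ^ N / algebraMap R (FractionRing R) b) ≤ 1 := by
          rw [map_div₀, map_pow]
          exact div_le_one_of_le₀ hN zero_le
        obtain ⟨c, s, hs, hcs⟩ := (h.2 _).1 h1
        have hs0' : algebraMap R (FractionRing R) s ≠ 0 := by
          simpa using fun h0 : s = 0 => hs (h0 ▸ P.zero_mem)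
        rw [div_eq_div_iff hb0' hs0', ← map_pow, ← map_mul, ← map_mul] at hcs
        have h2 : a ^ N * s ∈ Q := by
          rw [IsFractionRing.injective R (FractionRing R) hcs]
          exact Q.mul_mem_left _ hbQ
        rcases hQ.mem_or_mem h2 with h3 | h3
        · exact hQ.mem_of_pow_mem _ h3
        · exact absurd (hQP.le h3) hs
      subst hQ0
      simp
    simpa using this
  · have := Ideal.height_add_one_le_of_lt_of_isPrime (bot_lt_iff_ne_bot.2 hbot)
    simpa using this

/-- Both valuations have the same valuation ring, hence are equivalent. An element of value `exp
(-1)` has the largest value below one, a property that equivalence preserves, and its powers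
calibrate all other values. -/
theorem IsOrderAlong.unique (hv : IsOrderAlong P v) (hw : IsOrderAlong P w) : v = w := by
  have hle : ∀ f, v f ≤ 1 ↔ w f ≤ 1 := fun f => (hv.2 f).trans (hw.2 f).symm
  have hequiv : v.IsEquiv w := Valuation.isEquiv_iff_val_le_one.2 fun {f} => hle f
  have heq : ∀ f g, v f = v g ↔ w f = w g := fun f g => by
    rw [le_antisymm_iff, le_antisymm_iff, hequiv f g, hequiv g f]
  have hdisc : ∀ x : ℤᵐ⁰, x < 1 → x ≤ WithZero.exp (-1) := fun x hx => by
    by_cases hx0 : x = 0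
    · simp [hx0]
    · rw [← WithZero.exp_log hx0, ← WithZero.exp_zero, WithZero.exp_lt_exp] at hx
      rw [← WithZero.exp_log hx0, WithZero.exp_le_exp]
      omega
  have hexp : (WithZero.exp (-1) : ℤᵐ⁰) < 1 := by
    rw [← WithZero.exp_zero, WithZero.exp_lt_exp]
    omega
  obtain ⟨f, hf⟩ := hv.1 (WithZero.exp (-1))
  obtain ⟨g, hg⟩ := hw.1 (WithZero.exp (-1))
  have hwf : w f = WithZero.exp (-1) := by
    have h1 : w f ≤ w g := by
      rw [hg]
      exact hdisc _ ((Valuation.isEquiv_iff_val_lt_one.1 hequiv).1 (hf ▸ hexp))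
    have h2 : v g ≤ v f := by
      rw [hf]
      exact hdisc _ ((Valuation.isEquiv_iff_val_lt_one.1 hequiv).2 (hg ▸ hexp))
    rw [← hg]
    exact le_antisymm h1 ((hequiv g f).1 h2)
  ext x
  by_cases hx : v x = 0
  · rw [hx]
    have := (Valuation.zero_iff v).1 hx
    simp [this]
  · have h1 : v x = v (f ^ (-WithZero.log (v x))) := by
      rw [map_zpow₀, hf, ← WithZero.exp_zsmul, smul_eq_mul, neg_mul_neg, mul_one,
        WithZero.exp_log hx]
    have h2 := (heq _ _).1 h1
    rw [h2, map_zpow₀, hwf, ← hf, ← map_zpow₀]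
    exact h1

theorem eq_of_height_eq_one {P Q : Ideal R} (hP : P.IsPrime) (hQ : Q.IsPrime)
    (hP1 : P.height = 1) (hQ0 : Q ≠ ⊥) (hQP : Q ≤ P) : Q = P := by
  by_contra hne
  have h1 := Ideal.height_add_one_le_of_lt_of_isPrime (lt_of_le_of_ne hQP hne)
  have h2 := Ideal.height_add_one_le_of_lt_of_isPrime (bot_lt_iff_ne_bot.2 hQ0)
  rw [hP1] at h1
  have h3 : (⊥ : Ideal R).height + 1 + 1 ≤ 1 := (add_le_add_left h2 1).trans h1
  simp only [Ideal.height_bot, zero_add, one_add_one_eq_two] at h3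
  exact absurd h3 (by norm_num)

end Valuation

/-! ### The Laurent polynomial ring and the inclusion of the toric ring in it. -/

/-- The coordinate ring `k[M]` of the torus. -/
abbrev TorusRing (k : Type*) [Field k] (n : ℕ) : Type _ := AddMonoidAlgebra k (Fin n → ℤ)

instance torusRing_isDomain (k : Type*) [Field k] (n : ℕ) : IsDomain (TorusRing k n) :=
  NoZeroDivisors.to_isDomain _

/-- If every element of a group `G` becomes an element of the monoid `T` after adding a multiple of
`t`, then the group algebra of `G` is obtained from the monoid algebra of `T` by inverting `t`. -/
theorem isLocalization_mapDomainRingHom (k : Type*) [Field k] {T G : Type*} [AddCommMonoid T]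
    [AddCommGroup G] (f : T →+ G) (hf : Function.Injective f) (t : T)
    (ht : ∀ g : G, ∃ N : ℕ, ∃ s : T, f s = g + N • f t) :
    @IsLocalization.Away (AddMonoidAlgebra k T) _ (AddMonoidAlgebra.single t 1)
      (AddMonoidAlgebra k G) _ (AddMonoidAlgebra.mapDomainRingHom k f).toAlgebra := by
  let := (AddMonoidAlgebra.mapDomainRingHom k f).toAlgebra
  have hmap : ∀ x : AddMonoidAlgebra k T,
      algebraMap (AddMonoidAlgebra k T) (AddMonoidAlgebra k G) x =
        AddMonoidAlgebra.mapDomain f x := fun x => rfl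
  have hinj : Function.Injective (algebraMap (AddMonoidAlgebra k T) (AddMonoidAlgebra k G)) :=
    AddMonoidAlgebra.mapDomain_injective hf
  refine IsLocalization.Away.mk _ ?_ ?_ fun a b hab => ⟨0, by rw [hinj hab]⟩
  · rw [hmap, AddMonoidAlgebra.mapDomain_single]
    refine IsUnit.of_mul_eq_one (AddMonoidAlgebra.single (-f t) 1) ?_
    rw [AddMonoidAlgebra.single_mul_single, add_neg_cancel, mul_one]
    rfl
  · intro x
    rw [hmap, AddMonoidAlgebra.mapDomain_single]
    induction x using AddMonoidAlgebra.induction_linear with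
    | zero => exact ⟨0, 0, by simp⟩
    | add x y hx hy =>
      obtain ⟨N, a, ha⟩ := hx
      obtain ⟨N', b, hb⟩ := hy
      refine ⟨N + N', a * AddMonoidAlgebra.single t 1 ^ N' + b * AddMonoidAlgebra.single t 1 ^ N, ?_⟩
      rw [map_add, map_mul, map_mul, ← ha, ← hb, map_pow, map_pow, hmap,
        AddMonoidAlgebra.mapDomain_single]
      ring
    | single g c =>
      obtain ⟨N, s, hs⟩ := ht g
      refine ⟨N, AddMonoidAlgebra.single s c, ?_⟩
      rw [hmap, AddMonoidAlgebra.mapDomain_single, AddMonoidAlgebra.single_pow,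
        AddMonoidAlgebra.single_mul_single, hs, one_pow, mul_one]

/-- The inclusion of exponents `ℕ^n ⊆ ℤ^n`. -/
def natExponent (n : ℕ) : (Fin n →₀ ℕ) →+ (Fin n → ℤ) where
  toFun f i := (f i : ℤ)
  map_zero' := by ext; simp
  map_add' := by intros; ext; simp

theorem natExponent_injective (n : ℕ) : Function.Injective (natExponent n) := fun f g h => by
  ext i
  exact Int.ofNat_inj.1 (congrFun h i)

theorem isLocalization_mvPolynomial_torusRing (k : Type*) [Field k] (n : ℕ) :
    @IsLocalization.Away (MvPolynomial (Fin n) k) _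
      (AddMonoidAlgebra.single (Finsupp.equivFunOnFinite.symm fun _ => 1) 1)
      (TorusRing k n) _ (AddMonoidAlgebra.mapDomainRingHom k (natExponent n)).toAlgebra := by
  refine isLocalization_mapDomainRingHom k (natExponent n) (natExponent_injective n) _ fun g => ?_
  refine ⟨∑ i, (g i).natAbs,
    Finsupp.equivFunOnFinite.symm fun i => (g i + ∑ i, ((g i).natAbs : ℤ)).toNat, ?_⟩
  ext i
  have h : ((g i).natAbs : ℤ) ≤ ∑ i, ((g i).natAbs : ℤ) :=
    Finset.single_le_sum (f := fun i => ((g i).natAbs : ℤ)) (fun _ _ => by positivity)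
      (Finset.mem_univ i)
  have h' : 0 ≤ g i + ∑ i, ((g i).natAbs : ℤ) := by omega
  simp [natExponent] at h' ⊢
  omega

/-- Unique factorization gives reduced fractions over `k[M]`, through which poles inside the torus
are detected. -/
instance torusRing_uniqueFactorizationMonoid (k : Type*) [Field k] (n : ℕ) :
    UniqueFactorizationMonoid (TorusRing k n) := by
  let : Algebra (MvPolynomial (Fin n) k) (TorusRing k n) :=
    (AddMonoidAlgebra.mapDomainRingHom k (natExponent n)).toAlgebra
  have := isLocalization_mvPolynomial_torusRing k n
  exact UniqueFactorizationMonoid.of_isLocalization (M := MvPolynomial (Fin n) k)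
    (Submonoid.powers (AddMonoidAlgebra.single (Finsupp.equivFunOnFinite.symm fun _ => 1) 1)) _

/-- The inclusion `k[S] ⊆ k[M]`. -/
def toTorus (k : Type*) [Field k] {n : ℕ} (σ : PointedCone ℝ (Fin n → ℝ)) :
    ToricRing k σ →+* TorusRing k n :=
  AddMonoidAlgebra.mapDomainRingHom k (charMonoid σ).subtype

section

variable {k : Type*} [Field k] {n r : ℕ} {σ : PointedCone ℝ (Fin n → ℝ)}
  {v : Fin r → Fin n → ℤ}

theorem toTorus_injective : Function.Injective (toTorus k σ) :=
  AddMonoidAlgebra.mapDomain_injective Subtype.val_injective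

theorem toTorus_single (u : charMonoid σ) (c : k) :
    toTorus k σ (AddMonoidAlgebra.single u c) = AddMonoidAlgebra.single (u : Fin n → ℤ) c :=
  AddMonoidAlgebra.mapDomain_single

theorem coeff_toTorus (f : ToricRing k σ) (u : charMonoid σ) :
    (toTorus k σ f).coeff u = f.coeff u :=
  Finsupp.mapDomain_apply Subtype.val_injective _ _

theorem coeff_toTorus_of_notMem (f : ToricRing k σ) {u : Fin n → ℤ} (hu : u ∉ charMonoid σ) :
    (toTorus k σ f).coeff u = 0 :=
  Finsupp.mapDomain_of_notMem_range _ _ fun ⟨w, hw⟩ => hu (hw ▸ w.2)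

/-- A Laurent polynomial with exponents in `S` lies in `k[S]`. -/
theorem exists_toTorus_eq {g : TorusRing k n} (hg : ∀ u, g.coeff u ≠ 0 → u ∈ charMonoid σ) :
    ∃ f : ToricRing k σ, toTorus k σ f = g := by
  refine ⟨AddMonoidAlgebra.comapDomain (charMonoid σ).subtype Subtype.val_injective g, ?_⟩
  refine AddMonoidAlgebra.mapDomain_comapDomain (fun u hu => ?_) _
  exact ⟨⟨u, hg u (Finsupp.mem_support_iff.1 hu)⟩, rfl⟩

theorem FacetPresentation.exists_nsmul_add_mem (hf : FacetPresentation σ v) {w : Fin n → ℤ}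
    (hw : ∀ i, 0 < w ⬝ᵥ v i) (g : Fin n → ℤ) : ∃ N : ℕ, g + N • w ∈ charMonoid σ := by
  refine ⟨∑ i, (g ⬝ᵥ v i).natAbs, (hf.mem_charMonoid_iff _).2 fun i => ?_⟩
  have h : ((g ⬝ᵥ v i).natAbs : ℤ) ≤ ∑ i, ((g ⬝ᵥ v i).natAbs : ℤ) :=
    Finset.single_le_sum (f := fun i => ((g ⬝ᵥ v i).natAbs : ℤ)) (fun _ _ => by positivity)
      (Finset.mem_univ i)
  rw [add_dotProduct, smul_dotProduct, nsmul_eq_mul]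
  rw [Nat.cast_sum]
  have h1 : (∑ i, ((g ⬝ᵥ v i).natAbs : ℤ)) * 1 ≤ (∑ i, ((g ⬝ᵥ v i).natAbs : ℤ)) * (w ⬝ᵥ v i) :=
    mul_le_mul_of_nonneg_left (hw i) (Finset.sum_nonneg fun _ _ => by positivity)
  omega

theorem FacetPresentation.exists_interior_mem (hf : FacetPresentation σ v) :
    ∃ w : charMonoid σ, ∀ i, 0 < (w : Fin n → ℤ) ⬝ᵥ v i := by
  obtain ⟨w, hw⟩ := hf.exists_interior
  exact ⟨⟨w, (hf.mem_charMonoid_iff w).2 fun i => (hw i).le⟩, hw⟩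

/-- Adding a large multiple of an interior vector moves any lattice point into `S`, so inverting one
interior monomial inverts them all. -/
theorem FacetPresentation.isLocalization (hf : FacetPresentation σ v) {w : charMonoid σ}
    (hw : ∀ i, 0 < (w : Fin n → ℤ) ⬝ᵥ v i) :
    @IsLocalization.Away (ToricRing k σ) _ (AddMonoidAlgebra.single w 1)
      (TorusRing k n) _ (toTorus k σ).toAlgebra := by
  refine isLocalization_mapDomainRingHom k (charMonoid σ).subtype Subtype.val_injective w
    fun g => ?_
  obtain ⟨N, hN⟩ := hf.exists_nsmul_add_mem hw g
  exact ⟨N, ⟨_, hN⟩, rfl⟩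

/-- The field of fractions of `k[S]` contains `k[M]`. -/
theorem FacetPresentation.exists_torus_embedding (hf : FacetPresentation σ v) :
    ∃ j : TorusRing k n →+* FractionRing (ToricRing k σ),
      ∀ a, j (toTorus k σ a) = algebraMap _ _ a := by
  obtain ⟨w, hw⟩ := hf.exists_interior_mem
  let := (toTorus k σ).toAlgebra
  have := hf.isLocalization (k := k) hw
  have hu : IsUnit (algebraMap (ToricRing k σ) (FractionRing (ToricRing k σ))
      (AddMonoidAlgebra.single w 1)) := by
    rw [isUnit_iff_ne_zero]
    simp
  refine ⟨IsLocalization.Away.lift (S := TorusRing k n) _ hu, fun a => ?_⟩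
  exact RingHom.congr_fun
    (IsLocalization.Away.lift_comp (S := TorusRing k n) (AddMonoidAlgebra.single w 1) hu) a

/-- Every Laurent polynomial becomes an element of `k[S]` after multiplication by a monomial with
exponent a multiple of a given interior one. -/
theorem FacetPresentation.exists_clear (hf : FacetPresentation σ v) {w : charMonoid σ}
    (hw : ∀ i, 0 < (w : Fin n → ℤ) ⬝ᵥ v i) (g : TorusRing k n) :
    ∃ N : ℕ, ∃ f : ToricRing k σ,
      toTorus k σ f = g * AddMonoidAlgebra.single (N • (w : Fin n → ℤ)) 1 := by
  let := (toTorus k σ).toAlgebra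
  have := hf.isLocalization (k := k) hw
  obtain ⟨N, a, ha⟩ := IsLocalization.Away.surj (AddMonoidAlgebra.single w (1 : k)) g
  refine ⟨N, a, ?_⟩
  have h1 : algebraMap (ToricRing k σ) (TorusRing k n) (AddMonoidAlgebra.single w (1 : k)) =
    AddMonoidAlgebra.single (w : Fin n → ℤ) 1 := toTorus_single w 1
  rw [h1, AddMonoidAlgebra.single_pow, one_pow] at ha
  exact ha.symm

end

/-! ### Orders along the rays -/

section RayOrder

variable {k : Type*} [Field k] {n : ℕ}

/-- The map `χ^u ↦ χ^u T^(u · v)` to Hahn series in one variable over `k[M]`. -/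
def weightHom (k : Type*) [Field k] {n : ℕ} (v : Fin n → ℤ) :
    TorusRing k n →+* HahnSeries ℤ (TorusRing k n) :=
  AddMonoidAlgebra.liftNCRingHom
    (HahnSeries.C.comp (algebraMap k (TorusRing k n)))
    { toFun := fun u => HahnSeries.single (u.toAdd ⬝ᵥ v) (AddMonoidAlgebra.single u.toAdd 1)
      map_one' := by
        rw [toAdd_one, zero_dotProduct]
        rfl
      map_mul' := by
        intro a b
        rw [HahnSeries.single_mul_single, AddMonoidAlgebra.single_mul_single, toAdd_mul,
          add_dotProduct, mul_one] }
    fun _ _ => Commute.all _ _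

theorem weightHom_single (v u : Fin n → ℤ) (c : k) :
    weightHom k v (AddMonoidAlgebra.single u c) =
      HahnSeries.single (u ⬝ᵥ v) (AddMonoidAlgebra.single u c) := by
  refine (AddMonoidAlgebra.liftNC_single _ _ _ _).trans ?_
  change HahnSeries.single 0 (AddMonoidAlgebra.single 0 c) *
    HahnSeries.single (u ⬝ᵥ v) (AddMonoidAlgebra.single u 1) = _
  rw [HahnSeries.single_mul_single, AddMonoidAlgebra.single_mul_single, zero_add, zero_add, mul_one]

/-- The coefficient of `T^m` is the weight-`m` part of `f`, so the order of the Hahn series is the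
least weight. Additivity of that order comes from Hahn series over a domain. -/
theorem coeff_coeff_weightHom (v : Fin n → ℤ) (f : TorusRing k n) (m : ℤ) (u : Fin n → ℤ) :
    ((weightHom k v f).coeff m).coeff u = if u ⬝ᵥ v = m then f.coeff u else 0 := by
  induction f using AddMonoidAlgebra.induction_linear with
  | zero => simp
  | add f g hf hg =>
    rw [map_add, HahnSeries.coeff_add, AddMonoidAlgebra.coeff_add, AddMonoidAlgebra.coeff_add,
      Finsupp.add_apply, Finsupp.add_apply, hf, hg]
    split <;> simp
  | single w c =>
    rw [weightHom_single]
    by_cases hw : w = u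
    · subst hw
      by_cases hm : w ⬝ᵥ v = m
      · subst hm
        simp
      · rw [if_neg hm, HahnSeries.coeff_single_of_ne (Ne.symm hm)]
        rfl
    · rw [AddMonoidAlgebra.coeff_single, Finsupp.single_eq_of_ne (Ne.symm hw), ite_self]
      by_cases hm : w ⬝ᵥ v = m
      · subst hm
        rw [HahnSeries.coeff_single_same, AddMonoidAlgebra.coeff_single,
          Finsupp.single_eq_of_ne (Ne.symm hw)]
      · rw [HahnSeries.coeff_single_of_ne (Ne.symm hm)]
        rfl

theorem weightHom_ne_zero (v : Fin n → ℤ) {f : TorusRing k n} (hf : f ≠ 0) :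
    weightHom k v f ≠ 0 := by
  intro h
  refine hf (AddMonoidAlgebra.ext (Finsupp.ext fun u => ?_))
  have := coeff_coeff_weightHom v f (u ⬝ᵥ v) u
  rw [h, if_pos rfl] at this
  exact this.symm

/-- The order of a Laurent polynomial along the ray spanned by `v`: the least value of `u · v` on
its exponents. -/
def rayOrder (v : Fin n → ℤ) (f : TorusRing k n) : ℤ := (weightHom k v f).order

theorem rayOrder_le (v : Fin n → ℤ) {f : TorusRing k n} {u : Fin n → ℤ} (hu : f.coeff u ≠ 0) :
    rayOrder v f ≤ u ⬝ᵥ v := by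
  refine HahnSeries.order_le_of_coeff_ne_zero fun h => hu ?_
  have := coeff_coeff_weightHom v f (u ⬝ᵥ v) u
  rw [h, if_pos rfl] at this
  exact this.symm

theorem exists_eq_rayOrder (v : Fin n → ℤ) {f : TorusRing k n} (hf : f ≠ 0) :
    ∃ u, f.coeff u ≠ 0 ∧ u ⬝ᵥ v = rayOrder v f := by
  by_contra! h
  refine weightHom_ne_zero v hf (HahnSeries.coeff_order_eq_zero.1 ?_)
  refine AddMonoidAlgebra.ext (Finsupp.ext fun u => ?_)
  rw [coeff_coeff_weightHom]
  split
  · by_contra hu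
    exact h u hu ‹_›
  · rfl

theorem rayOrder_single (v u : Fin n → ℤ) {c : k} (hc : c ≠ 0) :
    rayOrder v (AddMonoidAlgebra.single u c) = u ⬝ᵥ v := by
  rw [rayOrder, weightHom_single, HahnSeries.order_single]
  simpa using hc

theorem rayOrder_one (v : Fin n → ℤ) : rayOrder v (1 : TorusRing k n) = 0 :=
  (rayOrder_single v 0 one_ne_zero).trans (zero_dotProduct v)

theorem rayOrder_mul (v : Fin n → ℤ) {f g : TorusRing k n} (hf : f ≠ 0) (hg : g ≠ 0) :
    rayOrder v (f * g) = rayOrder v f + rayOrder v g := by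
  rw [rayOrder, map_mul, HahnSeries.order_mul (weightHom_ne_zero v hf) (weightHom_ne_zero v hg)]
  rfl

/-- The valuation of `k[M]` attached to the ray spanned by `v`. -/
def rayValuation (k : Type*) [Field k] {n : ℕ} (v : Fin n → ℤ) : Valuation (TorusRing k n) ℤᵐ⁰ :=
  valuationOfOrder (rayOrder v)
    (rayOrder_one v)
    (fun _ _ hf hg => rayOrder_mul v hf hg)
    (fun f g _ _ hfg => by
      rw [rayOrder, rayOrder, rayOrder, map_add]
      refine HahnSeries.min_order_le_order_add ?_
      rw [← map_add]
      exact weightHom_ne_zero v hfg)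

theorem rayValuation_apply (v : Fin n → ℤ) {f : TorusRing k n} (hf : f ≠ 0) :
    rayValuation k v f = WithZero.exp (-rayOrder v f) :=
  valuationOfOrder_apply hf

end RayOrder

/-! ### Monomial ideals -/

section MonomialIdeals

variable {k : Type*} [Field k] {n r : ℕ} {σ : PointedCone ℝ (Fin n → ℝ)}
  {v : Fin r → Fin n → ℤ}

theorem mem_span_monomial_iff {T : Set (charMonoid σ)} {f : ToricRing k σ} :
    f ∈ Ideal.span (monomial k '' T) ↔
      ∀ u, f.coeff u ≠ 0 → ∃ t ∈ T, ∃ d, u = d + t := by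
  refine AddMonoidAlgebra.mem_ideal_span_of'_image.trans ?_
  simp only [Finsupp.mem_support_iff]

theorem monomial_mem_span_iff {T : Set (charMonoid σ)} {u : charMonoid σ} :
    monomial k u ∈ Ideal.span (monomial k '' T) ↔ ∃ t ∈ T, ∃ d, u = d + t := by
  rw [mem_span_monomial_iff]
  constructor
  · exact fun h => h u (by simp [monomial])
  · intro h w hw
    have : w = u := by
      by_contra hne
      exact hw (by rw [monomial, AddMonoidAlgebra.coeff_single, Finsupp.single_eq_of_ne hne])
    exact this ▸ h

/-- Pairings of elements of `S` with `v i` are nonnegative, so a sum pairs to zero only if both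
summands do. -/
theorem FacetPresentation.mem_rayIdeal_iff (hf : FacetPresentation σ v) {i : Fin r}
    {f : ToricRing k σ} :
    f ∈ rayIdeal k σ (v i) ↔ ∀ u : charMonoid σ, f.coeff u ≠ 0 → (u : Fin n → ℤ) ⬝ᵥ v i ≠ 0 := by
  refine mem_span_monomial_iff.trans ⟨fun h u hu => ?_, fun h u hu => ⟨u, h u hu, 0, by simp⟩⟩
  obtain ⟨t, ht, d, rfl⟩ := h u hu
  have h1 := (hf.mem_charMonoid_iff _).1 t.2 i
  have h2 := (hf.mem_charMonoid_iff _).1 d.2 i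
  have ht : (t : Fin n → ℤ) ⬝ᵥ v i ≠ 0 := ht
  rw [AddSubmonoid.coe_add, add_dotProduct]
  omega

theorem toTorus_ne_zero {f : ToricRing k σ} (hf : f ≠ 0) : toTorus k σ f ≠ 0 :=
  fun h => hf (toTorus_injective (h.trans (map_zero _).symm))

theorem coeff_toTorus_ne_zero {f : ToricRing k σ} {u : Fin n → ℤ}
    (hu : (toTorus k σ f).coeff u ≠ 0) : ∃ h : u ∈ charMonoid σ, f.coeff ⟨u, h⟩ ≠ 0 := by
  by_cases h : u ∈ charMonoid σ
  · exact ⟨h, by rwa [← coeff_toTorus]⟩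
  · exact absurd (coeff_toTorus_of_notMem f h) hu

theorem FacetPresentation.rayOrder_nonneg (hf : FacetPresentation σ v) (i : Fin r)
    {f : ToricRing k σ} (hf0 : f ≠ 0) : 0 ≤ rayOrder (v i) (toTorus k σ f) := by
  obtain ⟨u, hu, hu'⟩ := exists_eq_rayOrder (v i) (toTorus_ne_zero hf0)
  obtain ⟨h, -⟩ := coeff_toTorus_ne_zero hu
  rw [← hu']
  exact (hf.mem_charMonoid_iff u).1 h i

/-- This identifies the ray ideal as the locus of positive order; primality then follows from
additivity of the order. -/
theorem FacetPresentation.notMem_rayIdeal_iff (hf : FacetPresentation σ v) {i : Fin r}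
    {f : ToricRing k σ} (hf0 : f ≠ 0) :
    f ∉ rayIdeal k σ (v i) ↔ rayOrder (v i) (toTorus k σ f) = 0 := by
  rw [hf.mem_rayIdeal_iff]
  constructor
  · intro h
    push Not at h
    obtain ⟨u, hu, hu0⟩ := h
    refine le_antisymm ?_ (hf.rayOrder_nonneg i hf0)
    rw [← hu0]
    exact rayOrder_le _ (by rwa [coeff_toTorus])
  · intro h h1
    obtain ⟨u, hu, hu'⟩ := exists_eq_rayOrder (v i) (toTorus_ne_zero hf0)
    obtain ⟨hm, hc⟩ := coeff_toTorus_ne_zero hu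
    exact h1 ⟨u, hm⟩ hc (hu'.trans h)

theorem FacetPresentation.rayIdeal_isPrime (hf : FacetPresentation σ v) (i : Fin r) :
    (rayIdeal k σ (v i)).IsPrime := by
  refine Ideal.isPrime_iff.2 ⟨fun h => ?_, fun {f g} hfg => ?_⟩
  · have h1 : (1 : ToricRing k σ) ∈ rayIdeal k σ (v i) := h ▸ Submodule.mem_top
    refine (hf.notMem_rayIdeal_iff one_ne_zero).2 ?_ h1
    rw [map_one, rayOrder_one]
  · by_contra! h
    have hf0 : f ≠ 0 := fun h0 => h.1 (h0 ▸ Ideal.zero_mem _)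
    have hg0 : g ≠ 0 := fun h0 => h.2 (h0 ▸ Ideal.zero_mem _)
    refine (hf.notMem_rayIdeal_iff (mul_ne_zero hf0 hg0)).2 ?_ hfg
    rw [map_mul, rayOrder_mul _ (toTorus_ne_zero hf0) (toTorus_ne_zero hg0),
      (hf.notMem_rayIdeal_iff hf0).1 h.1, (hf.notMem_rayIdeal_iff hg0).1 h.2, add_zero]

theorem FacetPresentation.rayIdeal_ne_bot (hf : FacetPresentation σ v) (i : Fin r) :
    rayIdeal k σ (v i) ≠ ⊥ := by
  obtain ⟨w, hw⟩ := hf.exists_interior_mem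
  intro h
  have h1 : monomial k w ∈ rayIdeal k σ (v i) := Ideal.subset_span ⟨w, (hw i).ne', rfl⟩
  rw [h, Ideal.mem_bot, monomial] at h1
  simp at h1

theorem monomial_add (u w : charMonoid σ) :
    monomial k (u + w) = monomial k u * monomial k w := by
  rw [monomial, monomial, monomial, AddMonoidAlgebra.single_mul_single, mul_one]

theorem monomial_nsmul (u : charMonoid σ) (N : ℕ) : monomial k (N • u) = monomial k u ^ N := by
  rw [monomial, monomial, AddMonoidAlgebra.single_pow, one_pow]

theorem monomial_sum {ι : Type*} (s : Finset ι) (u : ι → charMonoid σ) :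
    monomial k (∑ i ∈ s, u i) = ∏ i ∈ s, monomial k (u i) := by
  classical
  induction s using Finset.induction_on with
  | empty => rfl
  | insert a s ha ih => rw [Finset.sum_insert ha, Finset.prod_insert ha, monomial_add, ih]

/-- A prime of height one that contains a monomial is the ideal of a ray. -/
theorem FacetPresentation.exists_eq_rayIdeal (hf : FacetPresentation σ v)
    {P : Ideal (ToricRing k σ)} (hP : P.IsPrime) (hP1 : P.height = 1) {u : charMonoid σ}
    (hu : monomial k u ∈ P) : ∃ i, P = rayIdeal k σ (v i) := by
  suffices h : ∃ i, rayIdeal k σ (v i) ≤ P by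
    obtain ⟨i, hi⟩ := h
    exact ⟨i, (eq_of_height_eq_one hP (hf.rayIdeal_isPrime i) hP1 (hf.rayIdeal_ne_bot i) hi).symm⟩
  by_contra! h
  have h1 : ∀ i, ∃ w : charMonoid σ, (w : Fin n → ℤ) ⬝ᵥ v i ≠ 0 ∧ monomial k w ∉ P := fun i => by
    by_contra! hc
    refine h i (Ideal.span_le.2 ?_)
    rintro _ ⟨w, hw, rfl⟩
    exact hc w hw
  choose w hw hwP using h1
  -- The sum of the `w j` is interior, so `χ^u` divides a power of its monomial. That power is then
  -- in `P`, although no factor is.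
  have hpos : ∀ i, 0 < ((∑ j, w j : charMonoid σ) : Fin n → ℤ) ⬝ᵥ v i := fun i => by
    rw [AddSubmonoid.coe_finsetSum, sum_dotProduct]
    refine Finset.sum_pos' (fun j _ => (hf.mem_charMonoid_iff _).1 (w j).2 i)
      ⟨i, Finset.mem_univ i, lt_of_le_of_ne ((hf.mem_charMonoid_iff _).1 (w i).2 i) (hw i).symm⟩
  obtain ⟨N, hN⟩ := hf.exists_nsmul_add_mem hpos (-(u : Fin n → ℤ))
  have h2 : N • ∑ j, w j = u + ⟨_, hN⟩ := by
    ext : 1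
    simp
  have h3 : monomial k (N • ∑ j, w j) ∈ P := by
    rw [h2, monomial_add]
    exact P.mul_mem_right _ hu
  rw [monomial_nsmul, monomial_sum] at h3
  obtain ⟨i, -, hi⟩ := (hP.prod_mem_iff).1 (hP.mem_of_pow_mem _ h3)
  exact hwP i hi

/-- A nonzero torus-invariant ideal contains a monomial. -/
theorem IsTorusInvariantIdeal.exists_monomial_mem {I : Ideal (ToricRing k σ)}
    (hI : IsTorusInvariantIdeal I) (h0 : I ≠ ⊥) : ∃ u, monomial k u ∈ I := by
  obtain ⟨f, hfI, hf0⟩ := Submodule.exists_mem_ne_zero_of_ne_bot h0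
  obtain ⟨u, hu⟩ : ∃ u, f.coeff u ≠ 0 := by
    by_contra! h
    exact hf0 (AddMonoidAlgebra.ext (Finsupp.ext h))
  refine ⟨u, ?_⟩
  -- The coaction records each exponent in the second tensor factor. Extracting the coefficient of
  -- `χ^u` there isolates one term of `f`, and this operation sends the extension of `I` back into
  -- `I`.
  let c : TorusRing k n →ₗ[k] k :=
    (Finsupp.lapply (u : Fin n → ℤ)).comp (AddMonoidAlgebra.coeffLinearEquiv k).toLinearMap
  let Φ : ToricRing k σ ⊗[k] TorusRing k n →ₗ[ToricRing k σ] ToricRing k σ :=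
    (TensorProduct.AlgebraTensorModule.rid k (ToricRing k σ) (ToricRing k σ)).toLinearMap.comp
      (TensorProduct.AlgebraTensorModule.map LinearMap.id c)
  have hΦ : ∀ x ∈ I.map (Algebra.TensorProduct.includeLeft :
      ToricRing k σ →ₐ[k] ToricRing k σ ⊗[k] TorusRing k n), Φ x ∈ I := by
    intro x hx
    suffices h : ∀ y, Φ (y * x) ∈ I by simpa using h 1
    refine Submodule.span_induction (p := fun x _ => ∀ y, Φ (y * x) ∈ I) ?_ ?_ ?_ ?_ hx
    · rintro _ ⟨g, hg, rfl⟩ y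
      have : y * g ⊗ₜ[k] (1 : TorusRing k n) = g • y := by
        induction y with
        | zero => rw [zero_mul, smul_zero]
        | add a b ha hb => rw [add_mul, smul_add, ha, hb]
        | tmul a b =>
          rw [Algebra.TensorProduct.tmul_mul_tmul, mul_one, TensorProduct.smul_tmul', smul_eq_mul,
            mul_comm]
      change Φ (y * g ⊗ₜ[k] (1 : TorusRing k n)) ∈ I
      rw [this, map_smul, smul_eq_mul]
      exact I.mul_mem_right _ hg
    · simp
    · intro a b _ _ ha hb y
      rw [mul_add, map_add]
      exact I.add_mem (ha y) (hb y)
    · intro a b _ hb y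
      rw [smul_eq_mul, ← mul_assoc]
      exact hb _
  have hco : ∀ g : ToricRing k σ, Φ (torusCoaction k σ g) = g.coeff u • monomial k u := by
    intro g
    induction g using AddMonoidAlgebra.induction_linear with
    | zero => simp
    | add f g hf hg =>
      rw [map_add, map_add, hf, hg, AddMonoidAlgebra.coeff_add, Finsupp.add_apply, add_smul]
    | single w b =>
      have h1 : torusCoaction k σ (AddMonoidAlgebra.single w b) =
          b • (monomial k w ⊗ₜ[k] AddMonoidAlgebra.single (w : Fin n → ℤ) (1 : k)) :=
        AddMonoidAlgebra.lift_single _ _ _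
      have h2 : Φ (monomial k w ⊗ₜ[k] AddMonoidAlgebra.single (w : Fin n → ℤ) (1 : k)) =
          c (AddMonoidAlgebra.single (w : Fin n → ℤ) (1 : k)) • monomial k w := rfl
      have h3 : c (AddMonoidAlgebra.single (w : Fin n → ℤ) (1 : k)) =
          Finsupp.single (w : Fin n → ℤ) (1 : k) u := rfl
      rw [h1, LinearMap.map_smul_of_tower, h2, h3, AddMonoidAlgebra.coeff_single]
      by_cases hwu : w = u
      · subst hwu
        simp
      · rw [Finsupp.single_eq_of_ne (Ne.symm hwu),
          Finsupp.single_eq_of_ne fun h => hwu (Subtype.ext h.symm)]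
        simp
  have h1 := hΦ _ (hI (Ideal.mem_map_of_mem _ hfI))
  rw [hco] at h1
  have h2 := I.smul_of_tower_mem (f.coeff u)⁻¹ h1
  rwa [smul_smul, inv_mul_cancel₀ hu, one_smul] at h2

end MonomialIdeals

/-! ### Sections of divisors supported on the boundary. -/

section Sections

variable {k : Type*} [Field k] {n r : ℕ} {σ : PointedCone ℝ (Fin n → ℝ)}
  {v : Fin r → Fin n → ℤ} {j : TorusRing k n →+* FractionRing (ToricRing k σ)}

theorem isFractionRing_of_torus_embedding (hj : ∀ a, j (toTorus k σ a) = algebraMap _ _ a)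
    (hf : FacetPresentation σ v) :
    @IsFractionRing (TorusRing k n) _ (FractionRing (ToricRing k σ)) _ j.toAlgebra := by
  obtain ⟨w, hw⟩ := hf.exists_interior_mem
  let _ := (toTorus k σ).toAlgebra
  let _ := j.toAlgebra
  have := hf.isLocalization (k := k) hw
  have : IsScalarTower (ToricRing k σ) (TorusRing k n) (FractionRing (ToricRing k σ)) :=
    IsScalarTower.of_algebraMap_eq fun a => (hj a).symm
  exact IsFractionRing.isFractionRing_of_isDomain_of_isLocalization
    (Submonoid.powers (AddMonoidAlgebra.single w (1 : k))) _ _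

theorem torus_embedding_injective (hj : ∀ a, j (toTorus k σ a) = algebraMap _ _ a)
    (hf : FacetPresentation σ v) : Function.Injective j := by
  let _ := j.toAlgebra
  have := isFractionRing_of_torus_embedding hj hf
  exact IsFractionRing.injective (TorusRing k n) (FractionRing (ToricRing k σ))

theorem coeff_mul_single_one (g : TorusRing k n) (w u : Fin n → ℤ) :
    (g * AddMonoidAlgebra.single w 1).coeff u = g.coeff (u - w) := by
  rw [AddMonoidAlgebra.coeff_mul_single_apply, mul_one, sub_eq_add_neg]

/-- If `g` is regular along the `i`-th divisor, it becomes an element of `k[S]` after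
multiplication by a large power of a monomial vanishing exactly along the other divisors. -/
theorem FacetPresentation.exists_toTorus_eq_facet (hf : FacetPresentation σ v) (i : Fin r)
    {w : Fin n → ℤ} (hw0 : w ⬝ᵥ v i = 0) (hw : ∀ j, j ≠ i → 0 < w ⬝ᵥ v j) (g : TorusRing k n)
    (hg : ∀ u, g.coeff u ≠ 0 → 0 ≤ u ⬝ᵥ v i) :
    ∃ N₀ : ℕ, ∀ N, N₀ ≤ N →
      ∃ f : ToricRing k σ, toTorus k σ f = g * AddMonoidAlgebra.single (N • w) 1 := by
  refine ⟨∑ u ∈ g.coeff.support, ∑ j, (u ⬝ᵥ v j).natAbs, fun N hN => exists_toTorus_eq ?_⟩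
  intro u hu
  rw [coeff_mul_single_one] at hu
  rw [hf.mem_charMonoid_iff]
  intro j
  obtain ⟨y, rfl⟩ : ∃ y, u = y + N • w := ⟨u - N • w, by simp⟩
  rw [add_sub_cancel_right] at hu
  rw [add_dotProduct, smul_dotProduct, nsmul_eq_mul]
  by_cases hji : j = i
  · subst hji
    rw [hw0, mul_zero, add_zero]
    exact hg y hu
  · have h1 : (y ⬝ᵥ v j).natAbs ≤ N := by
      refine le_trans (le_trans (b := ∑ j, (y ⬝ᵥ v j).natAbs) ?_ ?_) hN
      · exact Finset.single_le_sum (f := fun j => (y ⬝ᵥ v j).natAbs) (fun _ _ => Nat.zero_le _)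
          (Finset.mem_univ j)
      · exact Finset.single_le_sum (f := fun y : Fin n → ℤ => ∑ j, (y ⬝ᵥ v j).natAbs)
          (fun _ _ => Nat.zero_le _) (Finsupp.mem_support_iff.2 hu)
    have h2 : (N : ℤ) * 1 ≤ N * (w ⬝ᵥ v j) :=
      mul_le_mul_of_nonneg_left (hw j hji) (by positivity)
    omega

/-- The order along the `i`-th torus-invariant prime divisor. -/
theorem FacetPresentation.exists_isOrderAlong_rayIdeal (hf : FacetPresentation σ v)
    (hj : ∀ a, j (toTorus k σ a) = algebraMap _ _ a) (i : Fin r) :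
    ∃ w : Valuation (FractionRing (ToricRing k σ)) ℤᵐ⁰,
      IsOrderAlong (rayIdeal k σ (v i)) w ∧
        ∀ g, g ≠ 0 → w (j g) = WithZero.exp (-rayOrder (v i) g) := by
  let _ := j.toAlgebra
  have := isFractionRing_of_torus_embedding hj hf
  obtain ⟨w, hw⟩ := exists_valuation_extension (K := FractionRing (ToricRing k σ))
    (rayValuation k (v i)) fun a ha => valuationOfOrder_ne_zero ha
  have hwj : ∀ g, g ≠ 0 → w (j g) = WithZero.exp (-rayOrder (v i) g) := fun g hg =>
    (hw g).trans (rayValuation_apply _ hg)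
  obtain ⟨m, hm⟩ := hf.exists_eq_one i
  refine ⟨w, ⟨fun x => ?_, fun f => ⟨fun h => ?_, ?_⟩⟩, hwj⟩
  · by_cases hx : x = 0
    · exact ⟨0, by simp [hx]⟩
    · refine ⟨j (AddMonoidAlgebra.single (-WithZero.log x • m) 1), ?_⟩
      rw [hwj _ (by simp), rayOrder_single _ _ one_ne_zero, smul_dotProduct, hm, smul_eq_mul,
        mul_one, neg_neg, WithZero.exp_log hx]
  · obtain ⟨a, b, hb, rfl⟩ := IsFractionRing.div_surjective (A := ToricRing k σ) f
    have hb0 := nonZeroDivisors.ne_zero hb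
    by_cases ha0 : a = 0
    · exact ⟨0, 1, (hf.notMem_rayIdeal_iff one_ne_zero).2 (by rw [map_one, rayOrder_one]),
        by simp [ha0]⟩
    have ha0' := toTorus_ne_zero ha0
    have hb0' := toTorus_ne_zero hb0
    have hle : rayOrder (v i) (toTorus k σ b) ≤ rayOrder (v i) (toTorus k σ a) := by
      rw [map_div₀, ← hj, ← hj, hwj _ ha0', hwj _ hb0',
        div_le_one₀ WithZero.exp_pos, WithZero.exp_le_exp] at h
      linarith
    -- Dividing by `χ^(d m)` gives the denominator order zero along the `i`-th divisor. A power of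
    -- `χ^c` then clears the poles along the other divisors without changing this order.
    obtain ⟨c, hc0, hc⟩ := hf.exists_facet i
    set d := rayOrder (v i) (toTorus k σ b) with hd
    have hreg : ∀ x : ToricRing k σ, d ≤ rayOrder (v i) (toTorus k σ x) → ∀ u,
        (toTorus k σ x * AddMonoidAlgebra.single (-d • m) 1).coeff u ≠ 0 → 0 ≤ u ⬝ᵥ v i := by
      intro x hx u hu
      rw [coeff_mul_single_one] at hu
      have := rayOrder_le (v i) hu
      rw [sub_dotProduct, smul_dotProduct, hm, smul_eq_mul] at this
      linarith
    obtain ⟨N₁, h₁⟩ := hf.exists_toTorus_eq_facet i hc0 hc _ (hreg a hle)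
    obtain ⟨N₂, h₂⟩ := hf.exists_toTorus_eq_facet i hc0 hc _ (hreg b le_rfl)
    obtain ⟨a', ha'⟩ := h₁ (max N₁ N₂) (le_max_left _ _)
    obtain ⟨b', hb'⟩ := h₂ (max N₁ N₂) (le_max_right _ _)
    have hs : ∀ u : Fin n → ℤ, (AddMonoidAlgebra.single u 1 : TorusRing k n) ≠ 0 := by simp
    have hb'0 : b' ≠ 0 := fun h0 => by
      rw [h0, map_zero] at hb'
      exact mul_ne_zero (mul_ne_zero hb0' (hs _)) (hs _) hb'.symm
    refine ⟨a', b', (hf.notMem_rayIdeal_iff hb'0).2 ?_, ?_⟩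
    · rw [hb', rayOrder_mul _ (mul_ne_zero hb0' (hs _)) (hs _), rayOrder_mul _ hb0' (hs _),
        rayOrder_single _ _ one_ne_zero, rayOrder_single _ _ one_ne_zero, smul_dotProduct,
        smul_dotProduct, hm, hc0, ← hd]
      simp
    · have hinj := torus_embedding_injective hj hf
      have hjs : ∀ u : Fin n → ℤ, j (AddMonoidAlgebra.single u 1) ≠ 0 := fun u h0 =>
        hs u (hinj (h0.trans (map_zero j).symm))
      rw [← hj a', ← hj b', ha', hb', map_mul, map_mul, map_mul j (_ * _), map_mul,
        mul_div_mul_right _ _ (hjs _), mul_div_mul_right _ _ (hjs _), hj, hj]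
  · rintro ⟨a, s, hs, rfl⟩
    have hs0 : s ≠ 0 := fun h0 => hs (h0 ▸ Ideal.zero_mem _)
    by_cases ha0 : a = 0
    · simp [ha0]
    rw [map_div₀, ← hj, ← hj, hwj _ (toTorus_ne_zero ha0), hwj _ (toTorus_ne_zero hs0),
      (hf.notMem_rayIdeal_iff hs0).1 hs, neg_zero, WithZero.exp_zero, div_one, ← WithZero.exp_zero,
      WithZero.exp_le_exp]
    linarith [hf.rayOrder_nonneg i ha0]

theorem isUnit_single_one (u : Fin n → ℤ) :
    IsUnit (AddMonoidAlgebra.single u 1 : TorusRing k n) :=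
  IsUnit.of_mul_eq_one (AddMonoidAlgebra.single (-u) 1) (by
    rw [AddMonoidAlgebra.single_mul_single, add_neg_cancel, mul_one]
    rfl)

/-- The order along the closure of the prime divisor of the torus defined by a prime element. -/
theorem FacetPresentation.exists_isOrderAlong_comap (hf : FacetPresentation σ v)
    (hj : ∀ a, j (toTorus k σ a) = algebraMap _ _ a) {π : TorusRing k n} (hπ : Prime π) :
    ∃ w : Valuation (FractionRing (ToricRing k σ)) ℤᵐ⁰,
      IsOrderAlong ((Ideal.span {π}).comap (toTorus k σ)) w ∧
        ∀ g, g ≠ 0 → w (j g) = WithZero.exp (-(multiplicity π g : ℤ)) := by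
  let _ := j.toAlgebra
  have := isFractionRing_of_torus_embedding hj hf
  have hfin : ∀ a : TorusRing k n, a ≠ 0 → FiniteMultiplicity π a :=
    fun a ha => FiniteMultiplicity.of_prime_left hπ ha
  let ν : Valuation (TorusRing k n) ℤᵐ⁰ := valuationOfOrder (fun a => (multiplicity π a : ℤ))
    (by
      rw [Int.natCast_eq_zero, multiplicity_eq_zero]
      exact fun h => hπ.not_isUnit (isUnit_of_dvd_one h))
    (fun a b ha hb => by
      rw [multiplicity_mul hπ (hfin _ (mul_ne_zero ha hb))]
      push_cast
      rfl)
    (fun a b ha hb hab => by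
      have h := min_le_emultiplicity_add (p := π) (a := a) (b := b)
      rw [(hfin a ha).emultiplicity_eq_multiplicity, (hfin b hb).emultiplicity_eq_multiplicity,
        (hfin _ hab).emultiplicity_eq_multiplicity] at h
      rcases min_le_iff.1 h with h | h
      · exact (min_le_left _ _).trans (by exact_mod_cast h)
      · exact (min_le_right _ _).trans (by exact_mod_cast h))
  obtain ⟨w, hw⟩ := exists_valuation_extension (K := FractionRing (ToricRing k σ)) ν
    fun a ha => valuationOfOrder_ne_zero ha
  have hwj : ∀ g, g ≠ 0 → w (j g) = WithZero.exp (-(multiplicity π g : ℤ)) := fun g hg =>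
    (hw g).trans (valuationOfOrder_apply hg)
  have hle : ∀ g, w (j g) ≤ 1 := fun g => by
    by_cases hg : g = 0
    · simp [hg]
    · rw [hwj g hg, ← WithZero.exp_zero, WithZero.exp_le_exp]
      omega
  have hone : ∀ g, ¬ π ∣ g → w (j g) = 1 := fun g hg => by
    rw [hwj g fun h0 => hg (h0 ▸ dvd_zero π), multiplicity_eq_zero.2 hg]
    rfl
  refine ⟨w, ⟨fun x => ?_, fun f => ⟨fun h => ?_, ?_⟩⟩, hwj⟩
  · by_cases hx : x = 0
    · exact ⟨0, by simp [hx]⟩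
    · refine ⟨(j π) ^ (-WithZero.log x), ?_⟩
      rw [map_zpow₀, hwj π hπ.ne_zero, multiplicity_self, ← WithZero.exp_zsmul, smul_eq_mul,
        Nat.cast_one, neg_mul_neg, mul_one, WithZero.exp_log hx]
  · obtain ⟨a, b, hab, rfl⟩ := IsFractionRing.exists_reduced_fraction (TorusRing k n) f
    have hb0 : (b : TorusRing k n) ≠ 0 := nonZeroDivisors.ne_zero b.2
    rw [IsFractionRing.mk'_eq_div] at h ⊢
    change w (j a / j b) ≤ 1 at h
    change ∃ a' s, _ ∧ j a / j b = _
    -- In a reduced fraction at most one of `a` and `b` is divisible by `π`; if it were `b`, the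
    -- value would exceed one.
    have hb : ¬ π ∣ b := fun hb => by
      have ha : ¬ π ∣ a := fun ha => hπ.not_isUnit (hab ha hb)
      have hpos : 0 < multiplicity π (b : TorusRing k n) :=
        Nat.pos_of_ne_zero fun h0 => multiplicity_eq_zero.1 h0 hb
      rw [map_div₀, hone a ha, hwj b hb0, div_le_one₀ WithZero.exp_pos, ← WithZero.exp_zero,
        WithZero.exp_le_exp] at h
      omega
    obtain ⟨c, hc⟩ := hf.exists_interior_mem
    obtain ⟨N₁, a', ha'⟩ := hf.exists_clear (k := k) hc a
    obtain ⟨N₂, b', hb'⟩ := hf.exists_clear (k := k) hc b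
    have hunit : ∀ u : Fin n → ℤ, IsUnit (AddMonoidAlgebra.single u 1 : TorusRing k n) :=
      isUnit_single_one
    have hN : ∀ N : ℕ, toTorus k σ (monomial k (N • c)) =
        AddMonoidAlgebra.single (N • (c : Fin n → ℤ)) 1 := fun N => toTorus_single _ _
    have hjs : ∀ u : Fin n → ℤ, j (AddMonoidAlgebra.single u 1) ≠ 0 := fun u =>
      ((hunit u).map j).ne_zero
    refine ⟨a' * monomial k (N₂ • c), b' * monomial k (N₁ • c), ?_, ?_⟩
    · rw [Ideal.mem_comap, Ideal.mem_span_singleton, map_mul, hb', hN]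
      rwa [(hunit _).dvd_mul_right, (hunit _).dvd_mul_right]
    · have h1 : toTorus k σ (a' * monomial k (N₂ • c)) = a * (AddMonoidAlgebra.single (N₁ • (c : Fin n → ℤ)) 1 *
          AddMonoidAlgebra.single (N₂ • (c : Fin n → ℤ)) 1) := by
        rw [map_mul, ha', hN, mul_assoc]
      have h2 : toTorus k σ (b' * monomial k (N₁ • c)) = (b : TorusRing k n) *
          (AddMonoidAlgebra.single (N₁ • (c : Fin n → ℤ)) 1 *
            AddMonoidAlgebra.single (N₂ • (c : Fin n → ℤ)) 1) := by
        rw [map_mul, hb', hN, mul_assoc, mul_comm (AddMonoidAlgebra.single (N₂ • _) 1)]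
      rw [← hj, ← hj, h1, h2, map_mul, map_mul j (b : TorusRing k n), map_mul,
        mul_div_mul_right _ _ (mul_ne_zero (hjs _) (hjs _))]
  · rintro ⟨a, s, hs, rfl⟩
    rw [Ideal.mem_comap, Ideal.mem_span_singleton] at hs
    rw [map_div₀, ← hj, ← hj, hone _ hs, div_one]
    exact hle _

/-- Sections of a divisor supported on the boundary are Laurent polynomials, whose exponents are
bounded below by the divisor. -/
theorem FacetPresentation.exists_of_mem_sections (hf : FacetPresentation σ v)
    (hj : ∀ a, j (toTorus k σ a) = algebraMap _ _ a) {E : Ideal (ToricRing k σ) → ℤ}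
    (hE : ∀ P : Ideal (ToricRing k σ), P.IsPrime → (∀ u, monomial k u ∉ P) → E P = 0)
    {f : FractionRing (ToricRing k σ)} (hfE : f ∈ sections E) :
    ∃ g, j g = f ∧ ∀ u, g.coeff u ≠ 0 → ∀ i, -E (rayIdeal k σ (v i)) ≤ u ⬝ᵥ v i := by
  have hexp : ∀ g, j g = f → ∀ u, g.coeff u ≠ 0 → ∀ i, -E (rayIdeal k σ (v i)) ≤ u ⬝ᵥ v i := by
    rintro g rfl u hu i
    obtain ⟨w, hw, hwj⟩ := hf.exists_isOrderAlong_rayIdeal hj i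
    have hg : g ≠ 0 := fun h0 => hu (by rw [h0]; rfl)
    have hP := hf.rayIdeal_isPrime (k := k) i
    have h := hfE _ hP (hw.height_eq_one hP) w hw
    rw [hwj g hg, WithZero.exp_le_exp] at h
    linarith [rayOrder_le (v i) hu]
  suffices h : ∃ g, j g = f by
    obtain ⟨g, hg⟩ := h
    exact ⟨g, hg, hexp g hg⟩
  let _ := j.toAlgebra
  have := isFractionRing_of_torus_embedding hj hf
  obtain ⟨a, b, hab, rfl⟩ := IsFractionRing.exists_reduced_fraction (TorusRing k n) f
  have hb0 : (b : TorusRing k n) ≠ 0 := nonZeroDivisors.ne_zero b.2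
  rw [IsFractionRing.mk'_eq_div] at hfE ⊢
  change j a / j b ∈ sections E at hfE
  change ∃ g, j g = j a / j b
  -- A prime factor `π` of the reduced denominator would be a pole along the closure of a divisor of
  -- the torus. Its ideal contains no monomial, so `E` vanishes there and allows no pole.
  by_cases hb : IsUnit (b : TorusRing k n)
  · obtain ⟨c, hc⟩ := hb.exists_right_inv
    refine ⟨a * c, ?_⟩
    rw [eq_div_iff (hb.map j).ne_zero, ← map_mul, mul_assoc, mul_comm c, hc, mul_one]
  · obtain ⟨π, hπ, hπb⟩ := WfDvdMonoid.exists_irreducible_factor hb hb0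
    have hπ := hπ.prime
    obtain ⟨w, hw, hwj⟩ := hf.exists_isOrderAlong_comap hj hπ
    have hπa : ¬ π ∣ a := fun ha => hπ.not_isUnit (hab ha hπb)
    have hP : ((Ideal.span {π}).comap (toTorus k σ)).IsPrime :=
      ((Ideal.span_singleton_prime hπ.ne_zero).2 hπ).comap _
    have hmon : ∀ u, monomial k u ∉ (Ideal.span {π}).comap (toTorus k σ) := fun u hu => by
      rw [Ideal.mem_comap, Ideal.mem_span_singleton, monomial, toTorus_single] at hu
      exact hπ.not_isUnit (isUnit_of_dvd_unit hu (isUnit_single_one _))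
    have h := hfE _ hP (hw.height_eq_one hP) w hw
    have hpos : 0 < multiplicity π (b : TorusRing k n) :=
      Nat.pos_of_ne_zero fun h0 => multiplicity_eq_zero.1 h0 hπb
    rw [hE _ hP hmon, map_div₀, hwj a fun h0 => hπa (h0 ▸ dvd_zero π), hwj b hb0,
      multiplicity_eq_zero.2 hπa, ← WithZero.exp_sub, WithZero.exp_le_exp] at h
    omega

/-- A Laurent monomial whose exponent is bounded below by an effective divisor is a section of
it. -/
theorem FacetPresentation.single_mem_sections (hf : FacetPresentation σ v)
    (hj : ∀ a, j (toTorus k σ a) = algebraMap _ _ a) {E : Ideal (ToricRing k σ) → ℤ}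
    (hE : ∀ P, 0 ≤ E P) {y : Fin n → ℤ} (hy : ∀ i, -E (rayIdeal k σ (v i)) ≤ y ⬝ᵥ v i) :
    j (AddMonoidAlgebra.single y 1) ∈ sections E := by
  intro P hP hP1 w hw
  by_cases hmon : ∃ u, monomial k u ∈ P
  · obtain ⟨u, hu⟩ := hmon
    obtain ⟨i, rfl⟩ := hf.exists_eq_rayIdeal hP hP1 hu
    obtain ⟨w', hw', hwj⟩ := hf.exists_isOrderAlong_rayIdeal hj i
    rw [hw.unique hw', hwj _ (by simp), rayOrder_single _ _ one_ne_zero, WithZero.exp_le_exp]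
    linarith [hy i]
  -- If `P` contains no monomial, every Laurent monomial is a ratio of units at `P` and has order
  -- zero, so effectivity of `E` suffices.
  · push Not at hmon
    obtain ⟨c, hc⟩ := hf.exists_interior_mem
    obtain ⟨N, hN⟩ := hf.exists_nsmul_add_mem hc y
    have h1 : j (AddMonoidAlgebra.single y 1) * algebraMap _ _ (monomial k (N • c)) =
        algebraMap _ _ (monomial k (⟨_, hN⟩ : charMonoid σ)) := by
      rw [← hj, ← hj, ← map_mul, monomial, monomial, toTorus_single, toTorus_single,
        AddMonoidAlgebra.single_mul_single, mul_one]
      rfl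
    have h2 := congrArg w h1
    rw [map_mul, hw.map_eq_one hP (hmon _), hw.map_eq_one hP (hmon _), mul_one] at h2
    rw [h2, ← WithZero.exp_zero, WithZero.exp_le_exp]
    exact hE P

end Sections

/-! ### Frobenius-linear maps built from monomials. -/

section FrobeniusTrace

variable {k : Type*} [Field k] {n r : ℕ} {σ : PointedCone ℝ (Fin n → ℝ)}
  {v : Fin r → Fin n → ℤ} {j : TorusRing k n →+* FractionRing (ToricRing k σ)}
  (p : ℕ) [Fact p.Prime] [CharP k p] [PerfectField k]

theorem injective_nsmul_sub {q : ℕ} (hq : q ≠ 0) (w : Fin n → ℤ) :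
    Function.Injective fun m : charMonoid σ => q • (m : Fin n → ℤ) - w := by
  intro a b h
  have h1 : q • (a : Fin n → ℤ) = q • (b : Fin n → ℤ) := sub_left_injective h
  refine Subtype.ext (funext fun i => ?_)
  have h2 := congrFun h1 i
  simpa [hq] using h2

/-- The additive map `k[M] → k[S]` sending `c χ^u` to `c^(1/p^e) χ^((u + w)/p^e)` if the exponent
lies in `S`, and to zero otherwise. -/
def monomialTrace (k : Type*) [Field k] {n : ℕ} (σ : PointedCone ℝ (Fin n → ℝ)) (p : ℕ)
    [Fact p.Prime] [CharP k p] [PerfectField k] (e : ℕ) (w : Fin n → ℤ) :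
    TorusRing k n →+ ToricRing k σ :=
  (AddMonoidAlgebra.mapRingHom (charMonoid σ)
    ((iterateFrobeniusEquiv k p e).symm : k →+* k)).toAddMonoidHom.comp
    (AddMonoidAlgebra.comapDomainAddMonoidHom _
      (injective_nsmul_sub (pow_ne_zero e (Fact.out : p.Prime).ne_zero) w))

theorem coeff_monomialTrace (e : ℕ) (w : Fin n → ℤ) (g : TorusRing k n) (m : charMonoid σ) :
    (monomialTrace k σ p e w g).coeff m =
      (iterateFrobeniusEquiv k p e).symm (g.coeff (p ^ e • (m : Fin n → ℤ) - w)) := rfl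

theorem iterateFrobeniusEquiv_symm_pow_mul (e : ℕ) (c d : k) :
    (iterateFrobeniusEquiv k p e).symm (c ^ p ^ e * d) =
      c * (iterateFrobeniusEquiv k p e).symm d := by
  rw [map_mul, ← iterateFrobeniusEquiv_def, RingEquiv.symm_apply_apply]

instance torusRing_charP : CharP (TorusRing k n) p :=
  charP_of_injective_algebraMap (algebraMap k (TorusRing k n)).injective p

/-- The map `monomialTrace` is Frobenius-linear on Laurent polynomials from which it produces no
exponents outside of `S`. -/
theorem monomialTrace_pow_mul (e : ℕ) (w : Fin n → ℤ) (a : ToricRing k σ) (g : TorusRing k n)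
    (hg : ∀ u, g.coeff u ≠ 0 → ∀ m : Fin n → ℤ, p ^ e • m = u + w → m ∈ charMonoid σ) :
    monomialTrace k σ p e w (toTorus k σ a ^ p ^ e * g) = a * monomialTrace k σ p e w g := by
  induction a using AddMonoidAlgebra.induction_linear with
  | zero =>
    rw [map_zero, zero_pow (pow_ne_zero e (Fact.out : p.Prime).ne_zero), zero_mul, zero_mul,
      map_zero]
  | add a b ha hb =>
    rw [map_add, add_pow_char_pow, add_mul, map_add, ha, hb, add_mul]
  | single s c =>
    refine toTorus_injective (AddMonoidAlgebra.ext (Finsupp.ext fun m => ?_))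
    rw [map_mul (toTorus k σ), toTorus_single, AddMonoidAlgebra.single_pow,
      AddMonoidAlgebra.coeff_single_mul_apply]
    by_cases hm : m ∈ charMonoid σ
    · have h1 : (toTorus k σ (monomialTrace k σ p e w
          (AddMonoidAlgebra.single (p ^ e • (s : Fin n → ℤ)) (c ^ p ^ e) * g))).coeff m =
          c * (iterateFrobeniusEquiv k p e).symm
            (g.coeff (p ^ e • (-(s : Fin n → ℤ) + m) - w)) := by
        refine (coeff_toTorus _ (⟨m, hm⟩ : charMonoid σ)).trans ?_
        rw [coeff_monomialTrace, AddMonoidAlgebra.coeff_single_mul_apply,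
          iterateFrobeniusEquiv_symm_pow_mul, smul_add, smul_neg, add_sub_assoc]
      rw [h1]
      congr 1
      -- The trace of `g` discards exponents outside `S`, while multiplication by `χ^s` could bring
      -- them back into `S`. The hypothesis on `g` makes the discarded coefficients zero.
      by_cases hs : -(s : Fin n → ℤ) + m ∈ charMonoid σ
      · exact (coeff_toTorus (monomialTrace k σ p e w g) (⟨_, hs⟩ : charMonoid σ)).symm
      · rw [coeff_toTorus_of_notMem _ hs]
        by_contra h
        refine hs (hg (p ^ e • (-(s : Fin n → ℤ) + m) - w) (fun h0 => h ?_) _ (by simp))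
        rw [h0, map_zero]
    · rw [coeff_toTorus_of_notMem _ hm, coeff_toTorus_of_notMem, mul_zero]
      intro h
      refine hm ?_
      have := (charMonoid σ).add_mem s.2 h
      rwa [add_neg_cancel_left] at this

end FrobeniusTrace

/-! ### Colength of monomial ideals. -/

section Length

variable {k : Type*} [Field k] {n r : ℕ} {σ : PointedCone ℝ (Fin n → ℝ)}
  {v : Fin r → Fin n → ℤ}

theorem exists_add_of_coeff_mul_ne_zero {f g : ToricRing k σ} {u : charMonoid σ}
    (h : (f * g).coeff u ≠ 0) : ∃ a b, f.coeff a ≠ 0 ∧ g.coeff b ≠ 0 ∧ a + b = u := by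
  classical
  by_contra! hc
  refine h ?_
  rw [AddMonoidAlgebra.coeff_mul]
  refine Finset.sum_eq_zero fun a ha => Finset.sum_eq_zero fun b hb => ?_
  exact if_neg (hc a b (Finsupp.mem_support_iff.1 ha) (Finsupp.mem_support_iff.1 hb))

theorem coeff_one_zero : (1 : ToricRing k σ).coeff 0 = 1 := by
  rw [AddMonoidAlgebra.one_def, AddMonoidAlgebra.coeff_single, Finsupp.single_eq_same]

theorem coeff_monomial_mul (f : ToricRing k σ) (u w : charMonoid σ) :
    (monomial k u * f).coeff (u + w) = f.coeff w := by
  rw [← coeff_toTorus, map_mul, monomial, toTorus_single, AddMonoidAlgebra.coeff_single_mul_apply,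
    AddSubmonoid.coe_add, neg_add_cancel_left, one_mul, coeff_toTorus]

/-- The monomial ideal of the functions whose exponents avoid a set closed under taking summands. -/
def avoidingIdeal (k : Type*) [Field k] {n : ℕ} {σ : PointedCone ℝ (Fin n → ℝ)}
    (A : Set (charMonoid σ)) (hA : ∀ u d, u + d ∈ A → u ∈ A) : Ideal (ToricRing k σ) where
  carrier := {f | ∀ u ∈ A, f.coeff u = 0}
  zero_mem' := fun u _ => rfl
  add_mem' := by
    intro f g hf hg u hu
    rw [AddMonoidAlgebra.coeff_add, Finsupp.add_apply, hf u hu, hg u hu, add_zero]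
  smul_mem' := by
    intro c f hf u hu
    by_contra h
    obtain ⟨a, b, -, hb, rfl⟩ := exists_add_of_coeff_mul_ne_zero h
    exact hb (hf b (hA b a (add_comm a b ▸ hu)))

theorem FacetPresentation.eq_zero_of_add_eq_zero (hf : FacetPresentation σ v)
    (hv : ∀ u : Fin n → ℤ, (∀ i, u ⬝ᵥ v i = 0) → u = 0) {a b : charMonoid σ} (h : a + b = 0) :
    b = 0 := by
  refine Subtype.ext (hv _ fun i => ?_)
  have h1 := (hf.mem_charMonoid_iff _).1 a.2 i
  have h2 := (hf.mem_charMonoid_iff _).1 b.2 i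
  have h3 : ((a + b : charMonoid σ) : Fin n → ℤ) ⬝ᵥ v i = 0 := by
    rw [h]
    exact zero_dotProduct _
  rw [AddSubmonoid.coe_add, add_dotProduct] at h3
  omega

theorem FacetPresentation.mem_maxIdeal_iff (hf : FacetPresentation σ v)
    (hv : ∀ u : Fin n → ℤ, (∀ i, u ⬝ᵥ v i = 0) → u = 0) {f : ToricRing k σ} :
    f ∈ maxIdeal k σ ↔ f.coeff 0 = 0 := by
  refine mem_span_monomial_iff.trans ⟨fun h => ?_, fun h u hu => ⟨u, fun h0 => ?_, 0, by simp⟩⟩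
  · by_contra h0
    obtain ⟨t, ht, d, hd⟩ := h 0 h0
    exact ht (hf.eq_zero_of_add_eq_zero hv hd.symm)
  · exact hu (h0 ▸ h)

theorem FacetPresentation.maxIdeal_isMaximal (hf : FacetPresentation σ v)
    (hv : ∀ u : Fin n → ℤ, (∀ i, u ⬝ᵥ v i = 0) → u = 0) : (maxIdeal k σ).IsMaximal := by
  refine Ideal.isMaximal_iff.2 ⟨fun h => ?_, fun J f hJ hfm hfJ => ?_⟩
  · have := (hf.mem_maxIdeal_iff hv).1 h
    rw [coeff_one_zero] at this
    exact one_ne_zero this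
  · have h0 : f.coeff 0 ≠ 0 := fun h => hfm ((hf.mem_maxIdeal_iff hv).2 h)
    have h1 : (f.coeff 0)⁻¹ • f - 1 ∈ maxIdeal k σ := by
      refine (hf.mem_maxIdeal_iff hv).2 ?_
      rw [AddMonoidAlgebra.coeff_sub, Finsupp.sub_apply, AddMonoidAlgebra.coeff_smul_apply,
        smul_eq_mul, inv_mul_cancel₀ h0, coeff_one_zero, sub_self]
    have h2 := J.sub_mem (J.smul_of_tower_mem (f.coeff 0)⁻¹ hfJ) (hJ h1)
    rwa [sub_sub_cancel] at h2

/-- The colength of a monomial ideal of finite colength is the number of monomials outside. -/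
theorem FacetPresentation.length_quotient_avoidingIdeal (hf : FacetPresentation σ v)
    (hv : ∀ u : Fin n → ℤ, (∀ i, u ⬝ᵥ v i = 0) → u = 0) (N : ℕ) :
    ∀ (A : Finset (charMonoid σ)) (hA : ∀ u d, u + d ∈ (A : Set (charMonoid σ)) → u ∈ (A : Set _)),
      A.card = N →
      Module.length (ToricRing k σ) (ToricRing k σ ⧸ avoidingIdeal k (A : Set (charMonoid σ)) hA) =
        N := by
  classical
  induction N with
  | zero =>
    intro A hA hN
    rw [Finset.card_eq_zero] at hN
    subst hN
    rw [Nat.cast_zero, Module.length_eq_zero_iff, Submodule.Quotient.subsingleton_iff,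
      Ideal.eq_top_iff_one]
    exact fun u hu => absurd hu (by simp)
  | succ N ih =>
    intro A hA hN
    -- An element of `A` of maximal total pairing has no proper multiple in `A`. Hence `χ^u` is
    -- killed by the maximal ideal modulo `I`, and removing `u` splits off one copy of the residue
    -- field.
    obtain ⟨u, huA, hmax⟩ := A.exists_max_image
      (fun u : charMonoid σ => ∑ i, (u : Fin n → ℤ) ⬝ᵥ v i) (Finset.card_pos.1 (by omega))
    have htop : ∀ d, u + d ∈ A → d = 0 := fun d hd => by
      have h1 := hmax _ hd
      have hnn := fun i => (hf.mem_charMonoid_iff _).1 d.2 i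
      simp only [AddSubmonoid.coe_add, add_dotProduct, Finset.sum_add_distrib] at h1
      have h2 : ∑ i, (d : Fin n → ℤ) ⬝ᵥ v i = 0 :=
        le_antisymm (by linarith) (Finset.sum_nonneg fun i _ => hnn i)
      refine Subtype.ext (hv _ fun i => ?_)
      exact (Finset.sum_eq_zero_iff_of_nonneg fun i _ => hnn i).1 h2 i (Finset.mem_univ i)
    have hA' : ∀ w d, w + d ∈ ((A.erase u : Finset _) : Set (charMonoid σ)) →
        w ∈ ((A.erase u : Finset _) : Set (charMonoid σ)) := by
      intro w d h
      rw [Finset.mem_coe, Finset.mem_erase] at h ⊢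
      refine ⟨fun hw => h.1 ?_, hA w d h.2⟩
      subst hw
      rw [htop d h.2, add_zero]
    have hcard : (A.erase u).card = N := by rw [Finset.card_erase_of_mem huA, hN]; rfl
    let I := avoidingIdeal k (A : Set (charMonoid σ)) hA
    let I' := avoidingIdeal k ((A.erase u : Finset _) : Set (charMonoid σ)) hA'
    have hII' : I ≤ I' := fun f hfI w hw => hfI w (Finset.mem_of_mem_erase hw)
    have hmul : maxIdeal k σ ≤ Submodule.comap (LinearMap.mulLeft _ (monomial k u)) I := by
      intro f hfm w hw
      by_contra h
      obtain ⟨a, b, ha, hb, rfl⟩ := exists_add_of_coeff_mul_ne_zero h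
      have hau : a = u := by
        by_contra hne
        exact ha (by rw [monomial, AddMonoidAlgebra.coeff_single, Finsupp.single_eq_of_ne hne])
      subst hau
      rw [htop b hw] at hb
      exact hb ((hf.mem_maxIdeal_iff hv).1 hfm)
    have := hf.maxIdeal_isMaximal (k := k) hv
    have hsimple : IsSimpleModule (ToricRing k σ) (ToricRing k σ ⧸ maxIdeal k σ) :=
      isSimpleModule_iff_isCoatom.2 (Ideal.isMaximal_def.1 this)
    have key := Module.length_eq_add_of_exact
      (Submodule.mapQ (maxIdeal k σ) I (LinearMap.mulLeft _ (monomial k u)) hmul)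
      (Submodule.factor hII') ?_ ?_ ?_
    · refine key.trans ?_
      rw [Module.length_eq_one, ih (A.erase u) hA' hcard, add_comm]
      norm_cast
    · refine (injective_iff_map_eq_zero _).2 fun x hx => ?_
      obtain ⟨f, rfl⟩ := Submodule.Quotient.mk_surjective _ x
      rw [Submodule.mapQ_apply, Submodule.Quotient.mk_eq_zero] at hx
      rw [Submodule.Quotient.mk_eq_zero, hf.mem_maxIdeal_iff hv]
      have h1 : (monomial k u * f).coeff u = 0 := hx u huA
      rw [← coeff_monomial_mul f u 0, add_zero]
      exact h1
    · exact Submodule.factor_surjective hII'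
    · intro x
      obtain ⟨f, rfl⟩ := Submodule.Quotient.mk_surjective _ x
      constructor
      · intro h
        have hfI : f ∈ I' := (Submodule.Quotient.mk_eq_zero I').1 h
        refine ⟨Submodule.Quotient.mk (AddMonoidAlgebra.single 0 (f.coeff u)), ?_⟩
        rw [Submodule.mapQ_apply, LinearMap.mulLeft_apply, monomial,
          AddMonoidAlgebra.single_mul_single, add_zero, one_mul, Submodule.Quotient.eq]
        intro w hw
        rw [AddMonoidAlgebra.coeff_sub, Finsupp.sub_apply, AddMonoidAlgebra.coeff_single]
        by_cases hwu : w = u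
        · rw [hwu, Finsupp.single_eq_same, sub_self]
        · rw [Finsupp.single_eq_of_ne hwu, hfI w (Finset.mem_erase.2 ⟨hwu, hw⟩), sub_zero]
      · rintro ⟨y, hy⟩
        obtain ⟨g, rfl⟩ := Submodule.Quotient.mk_surjective _ y
        rw [← hy, Submodule.mapQ_apply]
        refine (Submodule.Quotient.mk_eq_zero I').2 fun w hw => ?_
        by_contra h
        obtain ⟨a, b, ha, -, rfl⟩ := exists_add_of_coeff_mul_ne_zero h
        have hau : a = u := by
          by_contra hne
          exact ha (by rw [monomial, AddMonoidAlgebra.coeff_single, Finsupp.single_eq_of_ne hne])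
        subst hau
        have hw := Finset.mem_erase.1 (Finset.mem_coe.1 hw)
        exact hw.1 (by rw [htop b hw.2, add_zero])

end Length

/-! ### Powers of monomial ideals. -/

section MonomialIdealPow

variable {k : Type*} [Field k] {n : ℕ} {σ : PointedCone ℝ (Fin n → ℝ)}

theorem IsMonomialIdeal.monomial_mem {I : Ideal (ToricRing k σ)} (hI : IsMonomialIdeal I)
    {f : ToricRing k σ} (hf : f ∈ I) {u : charMonoid σ} (hu : f.coeff u ≠ 0) :
    monomial k u ∈ I := by
  obtain ⟨T, rfl⟩ := hI
  exact monomial_mem_span_iff.2 (mem_span_monomial_iff.1 hf u hu)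

theorem span_monomial_pow (T : Set (charMonoid σ)) (N : ℕ) :
    Ideal.span (monomial k '' T) ^ N =
      Ideal.span (monomial k '' {u | ∃ t : Fin N → charMonoid σ, (∀ i, t i ∈ T) ∧ u = ∑ i, t i}) := by
  induction N with
  | zero =>
    rw [pow_zero, Ideal.one_eq_top, eq_comm, Ideal.eq_top_iff_one]
    exact Ideal.subset_span ⟨0, ⟨Fin.elim0, fun i => i.elim0, by simp⟩, rfl⟩
  | succ N ih =>
    rw [pow_succ, ih, Ideal.span_mul_span']
    congr 1
    ext f
    constructor
    · rintro ⟨_, ⟨u, ⟨t, ht, rfl⟩, rfl⟩, _, ⟨w, hw, rfl⟩, rfl⟩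
      refine ⟨∑ i, t i + w, ⟨Fin.snoc t w, ?_, ?_⟩, monomial_add _ _⟩
      · intro i
        refine Fin.lastCases ?_ (fun i => ?_) i
        · simpa using hw
        · simpa using ht i
      · rw [Fin.sum_univ_castSucc]
        simp
    · rintro ⟨u, ⟨t, ht, rfl⟩, rfl⟩
      rw [Fin.sum_univ_castSucc, monomial_add]
      exact Set.mul_mem_mul ⟨_, ⟨fun i => t i.castSucc, fun i => ht _, rfl⟩, rfl⟩
        ⟨_, ht _, rfl⟩

theorem IsMonomialIdeal.pow {I : Ideal (ToricRing k σ)} (hI : IsMonomialIdeal I) (N : ℕ) :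
    IsMonomialIdeal (I ^ N) := by
  obtain ⟨T, rfl⟩ := hI
  exact ⟨_, span_monomial_pow T N⟩

end MonomialIdealPow

/-! ### Computation of `I_e`. -/

section TripleIdeal

variable {k : Type*} [Field k] {n r : ℕ} {σ : PointedCone ℝ (Fin n → ℝ)}
  {v : Fin r → Fin n → ℤ} {j : TorusRing k n →+* FractionRing (ToricRing k σ)}
  (p : ℕ)

theorem roundUp_nonneg [Fact p.Prime] {R : Type*} [CommRing R] {D : QDivisor R} (hD : D.IsEffective) (e : ℕ)
    (P : Ideal R) : 0 ≤ roundUp p D e P := by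
  refine Int.ceil_nonneg (mul_nonneg (sub_nonneg.2 (one_le_pow₀ ?_)) (hD P))
  exact_mod_cast (Fact.out : p.Prime).one_lt.le

/-- A torus-invariant prime of height one is nonzero, hence contains a monomial; the other primes do
not occur in `D`. -/
theorem roundUp_eq_zero {D : QDivisor (ToricRing k σ)} (hD : IsTorusInvariant D) (e : ℕ)
    {P : Ideal (ToricRing k σ)} (hP : ∀ u, monomial k u ∉ P) : roundUp p D e P = 0 := by
  have h0 : D.coeff P = 0 := by
    by_contra h
    have hmem := Finsupp.mem_support_iff.2 h
    obtain ⟨u, hu⟩ := (hD P hmem).exists_monomial_mem fun h0 => by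
      have := D.height_of_mem P hmem
      rw [h0] at this
      simp at this
    exact hP u hu
  rw [roundUp, h0, mul_zero, Int.ceil_zero]

/-- For an exponent `u` of a section, `(u + w) · v_i > -p ^ e`. So if `u + w = p ^ e • m`, the
integer `m · v_i` exceeds `-1` and is nonnegative. The trace thus loses no exponent outside `S`,
which is what Frobenius-linearity on all sections requires. -/
theorem FacetPresentation.monomialTrace_mem_divisorHom [Fact p.Prime] [CharP k p] [PerfectField k]
    (hf : FacetPresentation σ v)
    (hj : ∀ a, j (toTorus k σ a) = algebraMap _ _ a) {D : QDivisor (ToricRing k σ)}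
    (hD : D.IsEffective) (hD' : IsTorusInvariant D) {e : ℕ} {w : Fin n → ℤ}
    (hw : ∀ i, roundUp p D e (rayIdeal k σ (v i)) - (p ^ e : ℕ) < w ⬝ᵥ v i) :
    (monomialTrace k σ p e w).comp (toTorus k σ).toAddMonoidHom ∈ divisorHom p D e := by
  have hinj := torus_embedding_injective hj hf
  have hadm : ∀ g : TorusRing k n,
      (∀ u, g.coeff u ≠ 0 → ∀ i, -roundUp p D e (rayIdeal k σ (v i)) ≤ u ⬝ᵥ v i) →
      ∀ u, g.coeff u ≠ 0 → ∀ m : Fin n → ℤ, p ^ e • m = u + w → m ∈ charMonoid σ := by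
    intro g hg u hu m hm
    refine (hf.mem_charMonoid_iff m).2 fun i => ?_
    have h1 : (p ^ e • m) ⬝ᵥ v i = (u + w) ⬝ᵥ v i := by rw [hm]
    rw [smul_dotProduct, add_dotProduct, nsmul_eq_mul] at h1
    have h2 := hg u hu i
    have h3 := hw i
    by_contra hneg
    have h4 : ((p ^ e : ℕ) : ℤ) * (m ⬝ᵥ v i) ≤ (p ^ e : ℕ) * (-1) :=
      mul_le_mul_of_nonneg_left (by omega) (by positivity)
    omega
  have hex := fun f : sections (roundUp p D e) => hf.exists_of_mem_sections hj
    (fun P _ hP => roundUp_eq_zero p hD' e hP) f.2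
  choose g hg hgE using hex
  have hgadd : ∀ x y, g (x + y) = g x + g y := fun x y => hinj (by
    rw [map_add, hg, hg, hg]; rfl)
  have hsmul : ∀ (a : ToricRing k σ) x, g (a ^ p ^ e • x) = toTorus k σ a ^ p ^ e * g x :=
    fun a x => hinj (by
      rw [hg, map_mul, map_pow, hj, hg, Submodule.coe_smul, Algebra.smul_def, map_pow])
  refine ⟨fun a x => ?_, ⟨AddMonoidHom.mk' (fun f => monomialTrace k σ p e w (g f)) fun x y => by
    rw [hgadd, map_add], fun a x => ?_, fun a ha => ?_⟩⟩
  · change monomialTrace k σ p e w (toTorus k σ (a ^ p ^ e * x)) =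
      a * monomialTrace k σ p e w (toTorus k σ x)
    rw [map_mul, map_pow]
    refine monomialTrace_pow_mul p e w a _ (hadm _ fun u hu i => ?_)
    obtain ⟨hu, -⟩ := coeff_toTorus_ne_zero hu
    linarith [(hf.mem_charMonoid_iff u).1 hu i, roundUp_nonneg p hD e (rayIdeal k σ (v i))]
  · change monomialTrace k σ p e w (g (a ^ p ^ e • x)) = a * monomialTrace k σ p e w (g x)
    rw [hsmul]
    exact monomialTrace_pow_mul p e w a _ (hadm _ (hgE x))
  · change monomialTrace k σ p e w (toTorus k σ a) = monomialTrace k σ p e w (g ⟨_, ha⟩)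
    congr 1
    exact hinj (by rw [hg, hj])

/-- Maps in `𝔇_e` send monomials far from the boundary into the maximal ideal. -/
theorem FacetPresentation.coeff_zero_of_mem_divisorHom [Fact p.Prime] (hf : FacetPresentation σ v)
    (hj : ∀ a, j (toTorus k σ a) = algebraMap _ _ a) {D : QDivisor (ToricRing k σ)}
    (hD : D.IsEffective) {e : ℕ} {φ : ToricRing k σ →+ ToricRing k σ}
    (hφ : φ ∈ divisorHom p D e) {x : charMonoid σ} {i : Fin r}
    (hx : (p ^ e : ℕ) - roundUp p D e (rayIdeal k σ (v i)) ≤ (x : Fin n → ℤ) ⬝ᵥ v i) (c : k) :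
    (φ (AddMonoidAlgebra.single x c)).coeff 0 = 0 := by
  obtain ⟨-, ψ, hψ, hφψ⟩ := hφ
  have hE : ∀ P, 0 ≤ roundUp p D e P := roundUp_nonneg p hD e
  obtain ⟨m₁, hm₁⟩ := hf.exists_eq_one i
  obtain ⟨c₁, hc0, hc⟩ := hf.exists_facet i
  -- This `m` lies just outside `S` across the `i`-th facet. The bound on `x` leaves room for `x + p
  -- ^ e • m` to remain the exponent of a section.
  obtain ⟨m, hmi, hmj⟩ : ∃ m : Fin n → ℤ, m ⬝ᵥ v i = -1 ∧ ∀ l, l ≠ i → 0 ≤ m ⬝ᵥ v l := by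
    refine ⟨(∑ l, (m₁ ⬝ᵥ v l).natAbs) • c₁ - m₁, ?_, fun l hl => ?_⟩
    · rw [sub_dotProduct, smul_dotProduct, hc0, hm₁, smul_zero, zero_sub]
    · have h : ((m₁ ⬝ᵥ v l).natAbs : ℤ) ≤ ∑ l, ((m₁ ⬝ᵥ v l).natAbs : ℤ) :=
        Finset.single_le_sum (f := fun i => ((m₁ ⬝ᵥ v i).natAbs : ℤ)) (fun _ _ => by positivity)
          (Finset.mem_univ l)
      rw [sub_dotProduct, smul_dotProduct, nsmul_eq_mul, Nat.cast_sum]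
      have h1 : (∑ i, ((m₁ ⬝ᵥ v i).natAbs : ℤ)) * 1 ≤
          (∑ i, ((m₁ ⬝ᵥ v i).natAbs : ℤ)) * (c₁ ⬝ᵥ v l) :=
        mul_le_mul_of_nonneg_left (hc l hl) (Finset.sum_nonneg fun _ _ => by positivity)
      omega
  have hmS : m ∉ charMonoid σ := fun h => by
    have := (hf.mem_charMonoid_iff m).1 h i
    omega
  have hxS := (hf.mem_charMonoid_iff _).1 x.2
  have hsec : ∀ y : Fin n → ℤ, (∀ l, -roundUp p D e (rayIdeal k σ (v l)) ≤ y ⬝ᵥ v l) →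
      j (AddMonoidAlgebra.single y c) ∈ sections (roundUp p D e) := fun y hy => by
    have h1 := (sections (roundUp p D e)).smul_mem (AddMonoidAlgebra.single 0 c)
      (hf.single_mem_sections hj hE hy)
    rwa [Algebra.smul_def, ← hj, toTorus_single, ← map_mul, AddMonoidAlgebra.single_mul_single,
      mul_one, AddSubmonoid.coe_zero, zero_add] at h1
  have hy : j (AddMonoidAlgebra.single (x + p ^ e • m) c) ∈ sections (roundUp p D e) := hsec _ fun l => by
    rw [add_dotProduct, smul_dotProduct, nsmul_eq_mul]
    by_cases hl : l = i
    · subst hl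
      rw [hmi]
      linarith
    · have := mul_nonneg (Int.natCast_nonneg (p ^ e)) (hmj l hl)
      linarith [hxS l, hE (rayIdeal k σ (v l))]
  have hxE : algebraMap _ _ (AddMonoidAlgebra.single x c : ToricRing k σ) ∈ sections (roundUp p D e) := by
    rw [← hj, toTorus_single]
    exact hsec _ fun l => by linarith [hxS l, hE (rayIdeal k σ (v l))]
  obtain ⟨b, hb⟩ := hf.exists_interior_mem
  obtain ⟨N, hN⟩ := hf.exists_nsmul_add_mem hb m
  have hsm : ∀ (a : ToricRing k σ) (z : TorusRing k n), a • j z = j (toTorus k σ a * z) :=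
    fun a z => by rw [map_mul, hj, Algebra.smul_def]
  -- Formally `φ (χ^x) = χ^(-m) ψ (χ^(x + p ^ e m))`; multiplying by `χ^(m + N b)` stays within
  -- `k[S]`. The constant term of `φ (χ^x)` is then the coefficient at `m ∉ S` of an element of
  -- `k[S]`.
  have key : monomial k (N • b) ^ p ^ e • (⟨_, hy⟩ : sections (roundUp p D e)) =
      monomial k (⟨_, hN⟩ : charMonoid σ) ^ p ^ e • (⟨_, hxE⟩ : sections (roundUp p D e)) := by
    refine Subtype.ext ?_
    change monomial k (N • b) ^ p ^ e • j (AddMonoidAlgebra.single (x + p ^ e • m) c) =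
      monomial k (⟨_, hN⟩ : charMonoid σ) ^ p ^ e •
        algebraMap _ _ (AddMonoidAlgebra.single x c : ToricRing k σ)
    rw [← hj, hsm, hsm, map_pow, map_pow, monomial, monomial, toTorus_single, toTorus_single,
      toTorus_single, AddMonoidAlgebra.single_pow, AddMonoidAlgebra.single_pow,
      AddMonoidAlgebra.single_mul_single, AddMonoidAlgebra.single_mul_single]
    congr 2
    rw [AddSubmonoidClass.coe_nsmul, smul_add]
    abel
  have h1 := congrArg ψ key
  rw [hψ, hψ, ← hφψ _ hxE] at h1
  have h2 := congrArg (fun f => (toTorus k σ f).coeff (m + N • (b : Fin n → ℤ))) h1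
  simp only [map_mul, monomial, toTorus_single, AddMonoidAlgebra.coeff_single_mul_apply,
    one_mul] at h2
  rw [neg_add_cancel, show -((N • b : charMonoid σ) : Fin n → ℤ) + (m + N • (b : Fin n → ℤ)) = m by
    rw [AddSubmonoidClass.coe_nsmul]; abel, coeff_toTorus_of_notMem _ hmS] at h2
  exact (coeff_toTorus _ (0 : charMonoid σ)).symm.trans h2.symm

/-- The exponents of the monomials that are split off by the maps defining `tripleIdeal`. -/
def splittingExponents (v : Fin r → Fin n → ℤ) (D : QDivisor (ToricRing k σ))
    (𝔞 : Ideal (ToricRing k σ)) (t : ℝ) (e : ℕ) : Set (charMonoid σ) :=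
  {u | ∃ a : charMonoid σ, monomial k a ∈ 𝔞 ^ ⌈((p : ℝ) ^ e - 1) * t⌉₊ ∧
    ∀ i, ((u + a : charMonoid σ) : Fin n → ℤ) ⬝ᵥ v i <
      (p ^ e : ℕ) - roundUp p D e (rayIdeal k σ (v i))}

theorem FacetPresentation.mem_splittingExponents_of_add (hf : FacetPresentation σ v)
    {D : QDivisor (ToricRing k σ)} {𝔞 : Ideal (ToricRing k σ)} {t : ℝ} {e : ℕ}
    (u d : charMonoid σ) (h : u + d ∈ splittingExponents p v D 𝔞 t e) :
    u ∈ splittingExponents p v D 𝔞 t e := by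
  obtain ⟨a, ha, h⟩ := h
  refine ⟨a, ha, fun i => lt_of_le_of_lt ?_ (h i)⟩
  simp only [AddSubmonoid.coe_add, add_dotProduct]
  linarith [(hf.mem_charMonoid_iff _).1 d.2 i]

/-- The trace with `w = -(u + a)`, premultiplied by `χ^a`, has as constant term the `p ^ e`-th root
of the coefficient of `f` at `u`; this detects every splitting exponent. For any other `u`, every
product with a monomial of the power of `𝔞` violates some facet bound, so all generating maps send
`χ^u` into the maximal ideal. -/
theorem FacetPresentation.tripleIdeal_eq [Fact p.Prime] [CharP k p] [PerfectField k]
    (hf : FacetPresentation σ v) (hv : ∀ u : Fin n → ℤ, (∀ i, u ⬝ᵥ v i = 0) → u = 0)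
    {D : QDivisor (ToricRing k σ)} (hD : D.IsEffective) (hD' : IsTorusInvariant D)
    {𝔞 : Ideal (ToricRing k σ)} (h𝔞 : IsMonomialIdeal 𝔞) (t : ℝ) (e : ℕ) :
    tripleIdeal p (maxIdeal k σ) D 𝔞 t e =
      avoidingIdeal k (splittingExponents p v D 𝔞 t e)
        (hf.mem_splittingExponents_of_add p) := by
  obtain ⟨j, hj⟩ := hf.exists_torus_embedding (k := k)
  refine le_antisymm (fun f hfI u hu => ?_) fun f hfI => ?_
  · obtain ⟨a, ha, hau⟩ := hu
    have hmem := hf.monomialTrace_mem_divisorHom p hj hD hD' (e := e)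
      (w := -((u + a : charMonoid σ) : Fin n → ℤ)) fun i => by
        rw [neg_dotProduct]
        linarith [hau i]
    have h1 := hfI _ (AddSubgroup.subset_closure ⟨1, _, hmem, _, ha, rfl⟩)
    rw [hf.mem_maxIdeal_iff hv] at h1
    have h2 : (monomialTrace k σ p e (-((u + a : charMonoid σ) : Fin n → ℤ))
        (toTorus k σ (monomial k a * (1 * f)))).coeff 0 = 0 := h1
    rw [coeff_monomialTrace, AddSubmonoid.coe_zero, smul_zero, zero_sub, neg_neg, coeff_toTorus,
      one_mul, add_comm u a, coeff_monomial_mul] at h2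
    simpa using h2
  · have hsingle : ∀ u ∉ splittingExponents p v D 𝔞 t e, ∀ c : k,
        AddMonoidAlgebra.single u c ∈ tripleIdeal p (maxIdeal k σ) D 𝔞 t e := by
      intro u hu c χ hχ
      rw [hf.mem_maxIdeal_iff hv]
      unfold tripleHom at hχ
      induction hχ using AddSubgroup.closure_induction with
      | zero => rfl
      | add x y _ _ hx hy =>
        rw [AddMonoidHom.add_apply, AddMonoidAlgebra.coeff_add, Finsupp.add_apply, hx, hy, add_zero]
      | neg x _ hx =>
        rw [AddMonoidHom.neg_apply, AddMonoidAlgebra.coeff_neg, Finsupp.neg_apply, hx, neg_zero]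
      | mem χ h =>
        obtain ⟨s, φ, hφ, a, ha, rfl⟩ := h
        change (φ (a * (s * AddMonoidAlgebra.single u c))).coeff 0 = 0
        rw [← mul_assoc]
        have hmon : ∀ b : charMonoid σ, (a * s).coeff b ≠ 0 →
            monomial k b ∈ 𝔞 ^ ⌈((p : ℝ) ^ e - 1) * t⌉₊ := fun b hb =>
          (h𝔞.pow _).monomial_mem (Ideal.mul_mem_right s _ ha) hb
        generalize a * s = g at hmon
        rw [← AddMonoidAlgebra.sum_coeff_single g, Finsupp.sum, Finset.sum_mul, map_sum,
          AddMonoidAlgebra.coeff_sum, Finsupp.finsetSum_apply]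
        refine Finset.sum_eq_zero fun b hb => ?_
        rw [AddMonoidAlgebra.single_mul_single]
        have hnot : ∃ i, (p ^ e : ℕ) - roundUp p D e (rayIdeal k σ (v i)) ≤
            ((b + u : charMonoid σ) : Fin n → ℤ) ⬝ᵥ v i := by
          by_contra! hc
          exact hu ⟨b, hmon b (Finsupp.mem_support_iff.1 hb), fun i => add_comm b u ▸ hc i⟩
        obtain ⟨i, hi⟩ := hnot
        exact hf.coeff_zero_of_mem_divisorHom p hj hD hφ hi _
    rw [← AddMonoidAlgebra.sum_coeff_single f]
    refine Ideal.sum_mem _ fun u hu => hsingle u (fun hu' => ?_) _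
    exact Finsupp.mem_support_iff.1 hu (hfI u hu')

end TripleIdeal

/-! ### The dimension of the toric ring. -/

section KrullDim

universe u

/-- Incomparability bounds chains in `B` by chains in `A`; lying over and going up lift chains from
`A` to `B`. -/
theorem ringKrullDim_eq_of_isIntegral {A B : Type*} [CommRing A] [CommRing B]
    [Algebra A B] [Algebra.IsIntegral A B] [FaithfulSMul A B] :
    ringKrullDim B = ringKrullDim A := by
  refine le_antisymm ?_ ?_
  · refine Order.krullDim_le_of_strictMono (PrimeSpectrum.comap (algebraMap A B)) fun P Q h => ?_
    exact Ideal.IsIntegral.comap_lt_comap (R := A) (I := P.asIdeal) (J := Q.asIdeal) h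
  · refine iSup_le fun l => ?_
    obtain ⟨Q, hQ, hQl⟩ := (Ideal.nonempty_primesOver (S := B) (RelSeries.head l).asIdeal).some
    obtain ⟨L, hL, -⟩ := Ideal.exists_ltSeries_of_hasGoingUp l Q
    rw [← hL]
    exact le_iSup (fun L : LTSeries (PrimeSpectrum B) => (L.length : WithBot ℕ∞)) L

theorem trdeg_eq_of_isAlgebraic {k : Type*} {A B : Type u} [Field k] [CommRing A] [IsDomain A]
    [CommRing B] [IsDomain B] [Algebra k A] [Algebra k B] [Algebra A B] [IsScalarTower k A B]
    [FaithfulSMul A B] [Algebra.IsAlgebraic A B] :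
    Algebra.trdeg k A = Algebra.trdeg k B := by
  rw [← trdeg_add_eq k A (A := B), trdeg_eq_zero (R := A) (A := B), add_zero]

/-- The transcendence degree does not change under localization. -/
theorem trdeg_eq_of_isLocalization_away {k : Type*} {A B : Type u} [Field k] [CommRing A]
    [IsDomain A] [CommRing B] [IsDomain B] [Algebra k A] [Algebra k B] (f : A →ₐ[k] B)
    (hf : Function.Injective f) (x : A)
    (h : @IsLocalization.Away A _ x B _ f.toRingHom.toAlgebra) :
    Algebra.trdeg k A = Algebra.trdeg k B := by
  let := f.toRingHom.toAlgebra
  have : IsScalarTower k A B := IsScalarTower.of_algebraMap_eq fun c => (f.commutes c).symm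
  have : FaithfulSMul A B := (faithfulSMul_iff_algebraMap_injective A B).2 hf
  have : Algebra.IsAlgebraic A B := IsLocalization.isAlgebraic B (Submonoid.powers x)
  exact trdeg_eq_of_isAlgebraic

/-- Noether normalization: `A` is integral over a polynomial ring, which has the same transcendence
degree and dimension. -/
theorem ringKrullDim_eq_of_trdeg {k : Type*} {A : Type u} [Field k] [CommRing A] [IsDomain A]
    [Algebra k A] [Algebra.FiniteType k A] {n : ℕ} (h : Algebra.trdeg k A = n) :
    ringKrullDim A = n := by
  obtain ⟨s, g, hg, hgi⟩ := exists_integral_inj_algHom_of_fg k A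
  let := g.toRingHom.toAlgebra
  have : IsScalarTower k (MvPolynomial (Fin s) k) A :=
    IsScalarTower.of_algebraMap_eq fun c => (g.commutes c).symm
  have : FaithfulSMul (MvPolynomial (Fin s) k) A :=
    (faithfulSMul_iff_algebraMap_injective _ A).2 hg
  have : Algebra.IsIntegral (MvPolynomial (Fin s) k) A := ⟨hgi⟩
  have h0 : Algebra.trdeg (MvPolynomial (Fin s) k) A = 0 := trdeg_eq_zero
  have h1 := lift_trdeg_add_eq k (MvPolynomial (Fin s) k) A
  rw [h0, h, MvPolynomial.trdeg_of_isDomain] at h1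
  have hs : s = n := by simpa using h1
  rw [ringKrullDim_eq_of_isIntegral (A := MvPolynomial (Fin s) k),
    MvPolynomial.ringKrullDim_of_isNoetherianRing, ringKrullDim_eq_zero_of_field]
  simp [hs]

end KrullDim

section

variable {k : Type*} [Field k] {n r : ℕ} {σ : PointedCone ℝ (Fin n → ℝ)} {v : Fin r → Fin n → ℤ}

/-- Gordan's lemma. -/
theorem FacetPresentation.charMonoid_fg (hf : FacetPresentation σ v)
    (hv : ∀ u : Fin n → ℤ, (∀ i, u ⬝ᵥ v i = 0) → u = 0) : (charMonoid σ).FG := by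
  rw [← AddMonoid.fg_iff_addSubmonoid_fg, AddMonoid.fg_def]
  have hnn : ∀ (u : charMonoid σ) i, 0 ≤ (u : Fin n → ℤ) ⬝ᵥ v i := fun u =>
    (hf.mem_charMonoid_iff _).1 u.2
  let φ : charMonoid σ →+ (Fin r → ℕ) :=
    { toFun := fun u i => ((u : Fin n → ℤ) ⬝ᵥ v i).toNat
      map_zero' := by ext i; simp
      map_add' := by
        intro a b
        ext i
        simp only [AddSubmonoid.coe_add, add_dotProduct, Pi.add_apply]
        exact Int.toNat_add (hnn a i) (hnn b i) }
  have hφ : ∀ u i, (φ u i : ℤ) = (u : Fin n → ℤ) ⬝ᵥ v i := fun u i => Int.toNat_of_nonneg (hnn u i)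
  have hinj : Function.Injective φ := by
    intro a b hab
    refine Subtype.ext (sub_eq_zero.1 (hv _ fun i => ?_))
    rw [sub_dotProduct, ← hφ, ← hφ, hab, sub_self]
  -- The pairings embed `S` in `ℕ^r`, and the image contains every difference of its elements that
  -- stays in `ℕ^r`; such submonoids are finitely generated.
  refine AddSubmonoid.FG.map_injective φ hinj (AddSubmonoid.fg_of_subtractive ?_)
  rintro _ ⟨a, -, rfl⟩ y ⟨b, -, hb⟩
  have hy : ∀ i, (y i : ℤ) = ((b : Fin n → ℤ) - (a : Fin n → ℤ)) ⬝ᵥ v i := by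
    intro i
    have := congrFun hb i
    rw [sub_dotProduct, ← hφ, ← hφ, this]
    simp
  refine ⟨⟨(b : Fin n → ℤ) - (a : Fin n → ℤ), (hf.mem_charMonoid_iff _).2 fun i => ?_⟩, trivial, ?_⟩
  · rw [← hy]
    exact Int.natCast_nonneg _
  · ext i
    have := hφ ⟨(b : Fin n → ℤ) - (a : Fin n → ℤ), (hf.mem_charMonoid_iff _).2 fun i => by
      rw [← hy]; exact Int.natCast_nonneg _⟩ i
    rw [← hy] at this
    exact_mod_cast this

/-- The rings `k[S]` and `k[x_1, …, x_n]` both localize to `k[M]`, hence have the same transcendence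
degree. -/
theorem FacetPresentation.ringKrullDim_toricRing (hf : FacetPresentation σ v)
    (hv : ∀ u : Fin n → ℤ, (∀ i, u ⬝ᵥ v i = 0) → u = 0) :
    ringKrullDim (ToricRing k σ) = n := by
  have : AddMonoid.FG (charMonoid σ) :=
    (AddMonoid.fg_iff_addSubmonoid_fg _).2 (hf.charMonoid_fg hv)
  obtain ⟨w, hw⟩ := hf.exists_interior_mem
  refine ringKrullDim_eq_of_trdeg (k := k) ?_
  have h1 : Algebra.trdeg k (ToricRing k σ) = Algebra.trdeg k (TorusRing k n) :=
    trdeg_eq_of_isLocalization_away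
      (AddMonoidAlgebra.mapDomainAlgHom k k (charMonoid σ).subtype)
      toTorus_injective _ (hf.isLocalization hw)
  have h2 : Algebra.trdeg k (MvPolynomial (Fin n) k) = Algebra.trdeg k (TorusRing k n) :=
    trdeg_eq_of_isLocalization_away
      (AddMonoidAlgebra.mapDomainAlgHom k k (natExponent n))
      (AddMonoidAlgebra.mapDomain_injective (natExponent_injective n)) _
      (isLocalization_mvPolynomial_torusRing k n)
  rw [h1, ← h2, MvPolynomial.trdeg_of_isDomain]
  simp

end

/-! ### Lattice points and volume. -/

section LatticePoints

open MeasureTheory Filter Topology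

variable {n : ℕ}

theorem toReal_injective : Function.Injective (toReal (n := n)) := fun u w h => by
  ext i
  exact Int.cast_injective (α := ℝ) (congrFun h i)

theorem range_toReal : Set.range (toReal (n := n)) =
    (Submodule.span ℤ (Set.range (Pi.basisFun ℝ (Fin n))) : Set (Fin n → ℝ)) := by
  ext x
  rw [SetLike.mem_coe, Module.Basis.mem_span_iff_repr_mem]
  constructor
  · rintro ⟨u, rfl⟩ i
    exact ⟨u i, by simp [toReal]⟩
  · intro h
    choose u hu using h
    exact ⟨u, funext fun i => by simpa [toReal] using hu i⟩

/-- The lattice points of `m • S`. -/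
def latticePoints (S : Set (Fin n → ℝ)) (m : ℝ) : Set (Fin n → ℤ) := {u | m⁻¹ • toReal u ∈ S}

theorem latticePoints_mono {S T : Set (Fin n → ℝ)} (h : S ⊆ T) (m : ℝ) :
    latticePoints S m ⊆ latticePoints T m := fun _ hu => h hu

theorem image_latticePoints (S : Set (Fin n → ℝ)) (m : ℝ) :
    (fun u => m⁻¹ • toReal u) '' latticePoints S m =
      S ∩ m⁻¹ • (Submodule.span ℤ (Set.range (Pi.basisFun ℝ (Fin n))) : Set (Fin n → ℝ)) := by
  rw [← range_toReal]
  ext x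
  constructor
  · rintro ⟨u, hu, rfl⟩
    exact ⟨hu, Set.smul_mem_smul_set ⟨u, rfl⟩⟩
  · rintro ⟨hx, _, ⟨u, rfl⟩, rfl⟩
    exact ⟨u, hx, rfl⟩

theorem inv_smul_toReal_injective {m : ℝ} (hm : m ≠ 0) :
    Function.Injective fun u : Fin n → ℤ => m⁻¹ • toReal u :=
  (smul_right_injective _ (inv_ne_zero hm)).comp toReal_injective

theorem latticePoints_finite {S : Set (Fin n → ℝ)} (hS : Bornology.IsBounded S) {m : ℝ}
    (hm : m ≠ 0) : (latticePoints S m).Finite := by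
  have h := (ZSpan.setFinite_inter (Pi.basisFun ℝ (Fin n)) (hS.smul₀ m)).preimage
    (f := toReal) toReal_injective.injOn
  refine h.subset fun u hu => ⟨⟨_, hu, by simp [smul_smul, hm]⟩, ?_⟩
  rw [← range_toReal]
  exact ⟨u, rfl⟩

theorem ncard_latticePoints (S : Set (Fin n → ℝ)) {m : ℝ} (hm : m ≠ 0) :
    (latticePoints S m).ncard =
      Nat.card ↑(S ∩ m⁻¹ • (Submodule.span ℤ (Set.range (Pi.basisFun ℝ (Fin n))) :
        Set (Fin n → ℝ))) := by
  rw [← image_latticePoints, Nat.card_coe_set_eq,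
    Set.ncard_image_of_injective _ (inv_smul_toReal_injective hm)]

theorem tendsto_ncard_latticePoints_of_measurableSet {S : Set (Fin n → ℝ)}
    (hS : Bornology.IsBounded S) (hS' : MeasurableSet S) (hfr : volume (frontier S) = 0) :
    Tendsto (fun m : ℕ => ((latticePoints S m).ncard : ℝ) / (m : ℝ) ^ n) atTop
      (𝓝 (volume.real S)) := by
  have h := tendsto_card_div_pow_atTop_volume S hS hS' hfr
  rw [Fintype.card_fin] at h
  refine h.congr' ?_
  filter_upwards [eventually_ne_atTop 0] with m hm
  rw [ncard_latticePoints S (Nat.cast_ne_zero.2 hm)]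

/-- The volume of a bounded convex set is the limit of the normalized numbers of lattice points of
its dilations. -/
theorem tendsto_ncard_latticePoints {S : Set (Fin n → ℝ)} (hS : Bornology.IsBounded S)
    (hc : Convex ℝ S) :
    Tendsto (fun m : ℕ => ((latticePoints S m).ncard : ℝ) / (m : ℝ) ^ n) atTop
      (𝓝 (volume.real S)) := by
  have hfr := hc.addHaar_frontier volume
  have hi : volume (interior S) = volume S := measure_interior_of_null_frontier hfr
  have hcl : volume (closure S) = volume S := measure_closure_of_null_frontier hfr
  -- The set `S` is not assumed Borel, so its count is squeezed between those of its interior and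
  -- closure. Their volumes agree because a convex set has null frontier.
  have h1 := tendsto_ncard_latticePoints_of_measurableSet (hS.subset interior_subset)
    measurableSet_interior (hc.interior.addHaar_frontier volume)
  have h2 := tendsto_ncard_latticePoints_of_measurableSet hS.closure
    measurableSet_closure (hc.closure.addHaar_frontier volume)
  rw [measureReal_def, hi, ← measureReal_def] at h1
  rw [measureReal_def, hcl, ← measureReal_def] at h2
  refine tendsto_of_tendsto_of_tendsto_of_le_of_le' h1 h2 ?_ ?_
  · filter_upwards [eventually_ne_atTop 0] with m hm
    gcongr
    · exact latticePoints_finite hS (Nat.cast_ne_zero.2 hm)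
    · exact latticePoints_mono interior_subset _
  · filter_upwards [eventually_ne_atTop 0] with m hm
    gcongr
    · exact latticePoints_finite hS.closure (Nat.cast_ne_zero.2 hm)
    · exact latticePoints_mono subset_closure _

end LatticePoints

/-! ### Polytopes with weak inequalities. -/

section TranslatedPolytope

open MeasureTheory

variable {n r : ℕ} {v : Fin r → Fin n → ℤ}

/-- The points `w` with `0 ≤ w · v_i` for all `i` some translate of which by an element `y` of `Y`
satisfies `(w + y) · v_i ≤ b_i` for all `i`. -/
def translatedPolytope (v : Fin r → Fin n → ℤ) (b : Fin r → ℝ) (Y : Set (Fin n → ℝ)) :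
    Set (Fin n → ℝ) :=
  {w | (∀ i, 0 ≤ w ⬝ᵥ toReal (v i)) ∧ ∃ y ∈ Y, ∀ i, (w + y) ⬝ᵥ toReal (v i) ≤ b i}

theorem translatedPolytope_mono {b c : Fin r → ℝ} (hbc : b ≤ c) {Y Z : Set (Fin n → ℝ)}
    (hYZ : Y ⊆ Z) : translatedPolytope v b Y ⊆ translatedPolytope v c Z := by
  rintro w ⟨h0, y, hy, h⟩
  exact ⟨h0, y, hYZ hy, fun i => (h i).trans (hbc i)⟩

theorem convex_translatedPolytope (b : Fin r → ℝ) {Y : Set (Fin n → ℝ)} (hY : Convex ℝ Y) :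
    Convex ℝ (translatedPolytope v b Y) := by
  rintro w ⟨h0, y, hy, h⟩ w' ⟨h0', y', hy', h'⟩ c d hc hd hcd
  refine ⟨fun i => ?_, c • y + d • y', hY hy hy' hc hd hcd, fun i => ?_⟩
  · rw [add_dotProduct, smul_dotProduct, smul_dotProduct]
    exact add_nonneg (mul_nonneg hc (h0 i)) (mul_nonneg hd (h0' i))
  · have e : c • w + d • w' + (c • y + d • y') = c • (w + y) + d • (w' + y') := by module
    rw [e, add_dotProduct, smul_dotProduct, smul_dotProduct]
    calc c • ((w + y) ⬝ᵥ toReal (v i)) + d • ((w' + y') ⬝ᵥ toReal (v i))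
        ≤ c • b i + d • b i :=
          add_le_add (smul_le_smul_of_nonneg_left (h i) hc) (smul_le_smul_of_nonneg_left (h' i) hd)
      _ = b i := by rw [← add_smul, hcd, one_smul]

/-- As `y · v_i ≥ 0`, the pairings of `w` lie in the box between `0` and `b`. An injective linear
map on a finite-dimensional space has bounded preimages of bounded sets. -/
theorem isBounded_translatedPolytope
    (hv : ∀ x : Fin n → ℝ, (∀ i, x ⬝ᵥ toReal (v i) = 0) → x = 0) (b : Fin r → ℝ)
    {Y : Set (Fin n → ℝ)} (hY : ∀ y ∈ Y, ∀ i, 0 ≤ y ⬝ᵥ toReal (v i)) :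
    Bornology.IsBounded (translatedPolytope v b Y) := by
  let f : (Fin n → ℝ) →ₗ[ℝ] (Fin r → ℝ) := LinearMap.pi fun i =>
    (dotProductBilin ℝ ℝ).flip (toReal (v i))
  have hf : ∀ x i, f x i = x ⬝ᵥ toReal (v i) := fun x i => rfl
  have hker : LinearMap.ker f = ⊥ := by
    rw [LinearMap.ker_eq_bot']
    intro x hx
    exact hv x fun i => by rw [← hf, hx, Pi.zero_apply]
  obtain ⟨K, -, hK⟩ := f.exists_antilipschitzWith hker
  refine (hK.isBounded_preimage (Metric.isBounded_Icc (0 : Fin r → ℝ) b)).subset ?_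
  rintro w ⟨h0, y, hy, h⟩
  refine ⟨fun i => h0 i, fun i => ?_⟩
  have := h i
  rw [add_dotProduct] at this
  rw [hf]
  linarith [hY y hy i]

end TranslatedPolytope

/-! ### The polytope of the triple and its approximations. -/

section Polytope

open MeasureTheory Filter Topology

variable {k : Type*} [Field k] {n r : ℕ} {σ : PointedCone ℝ (Fin n → ℝ)} {v : Fin r → Fin n → ℤ}

/-- The numbers `1 - a_i`. -/
def coCoeff (v : Fin r → Fin n → ℤ) (D : QDivisor (ToricRing k σ)) (i : Fin r) : ℝ :=
  1 - ((D.coeff (rayIdeal k σ (v i)) : ℚ) : ℝ)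

/-- A strict integer inequality loses one, which turns `p ^ e` into `p ^ e - 1`, the factor
multiplying `D`. This is why the natural dilation factor is `p ^ e - 1`. -/
theorem lt_sub_roundUp_iff {p : ℕ} {D : QDivisor (ToricRing k σ)} {e : ℕ} {i : Fin r} {z : ℤ} :
    z < (p ^ e : ℕ) - roundUp p D e (rayIdeal k σ (v i)) ↔
      (z : ℝ) ≤ ((p : ℝ) ^ e - 1) * coCoeff v D i := by
  have h1 : z < (p ^ e : ℕ) - roundUp p D e (rayIdeal k σ (v i)) ↔
      roundUp p D e (rayIdeal k σ (v i)) ≤ (p : ℤ) ^ e - 1 - z := by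
    push_cast
    constructor <;> intro h <;> linarith
  rw [h1, roundUp, Int.ceil_le, ← Rat.cast_le (K := ℝ), coCoeff]
  push_cast
  constructor <;> intro h <;> linarith

/-- The exponent, in `M_ℝ`, of a monomial of `𝔞`. -/
def realExponent (𝔞 : Ideal (ToricRing k σ)) (u : {u : charMonoid σ // monomial k u ∈ 𝔞}) :
    Fin n → ℝ :=
  toReal (u : Fin n → ℤ)

theorem newtonPolyhedron_eq (𝔞 : Ideal (ToricRing k σ)) :
    newtonPolyhedron 𝔞 = convexHull ℝ (Set.range (realExponent 𝔞)) := by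
  rw [newtonPolyhedron]
  congr 1
  ext x
  constructor
  · rintro ⟨u, hu, rfl⟩
    exact ⟨⟨u, hu⟩, rfl⟩
  · rintro ⟨u, rfl⟩
    exact ⟨u, u.2, rfl⟩

theorem FacetPresentation.toReal_dotProduct_nonneg (hf : FacetPresentation σ v)
    (u : charMonoid σ) (i : Fin r) : 0 ≤ toReal (u : Fin n → ℤ) ⬝ᵥ toReal (v i) := by
  rw [toReal_dotProduct]
  exact_mod_cast (hf.mem_charMonoid_iff _).1 u.2 i

theorem FacetPresentation.newtonPolyhedron_nonneg (hf : FacetPresentation σ v)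
    {𝔞 : Ideal (ToricRing k σ)} {y : Fin n → ℝ} (hy : y ∈ newtonPolyhedron 𝔞) (i : Fin r) :
    0 ≤ y ⬝ᵥ toReal (v i) := by
  have hc : Convex ℝ {y : Fin n → ℝ | 0 ≤ y ⬝ᵥ toReal (v i)} :=
    (convex_Ici (0 : ℝ)).linear_preimage ((dotProductBilin ℝ ℝ).flip (toReal (v i)))
  refine convexHull_min ?_ hc hy
  rintro _ ⟨u, -, rfl⟩
  exact hf.toReal_dotProduct_nonneg u i

theorem FacetPresentation.smul_newtonPolyhedron_nonneg (hf : FacetPresentation σ v)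
    {𝔞 : Ideal (ToricRing k σ)} {t : ℝ} (ht : 0 ≤ t) {y : Fin n → ℝ}
    (hy : y ∈ t • newtonPolyhedron 𝔞) (i : Fin r) : 0 ≤ y ⬝ᵥ toReal (v i) := by
  obtain ⟨y, hy, rfl⟩ := hy
  rw [smul_dotProduct]
  exact mul_nonneg ht (hf.newtonPolyhedron_nonneg hy i)

/-- The lower bounds of `P_σ^D` at `w + y` are automatic, since both `w` and `y` pair nonnegatively
with each `v i`. -/
theorem FacetPresentation.mem_triplePolytope_iff (hf : FacetPresentation σ v)
    (hv : IsPrimitiveGenerators σ v)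
    {D : QDivisor (ToricRing k σ)} {𝔞 : Ideal (ToricRing k σ)} {t : ℝ} (ht : 0 ≤ t)
    {w : Fin n → ℝ} :
    w ∈ triplePolytope v D 𝔞 t ↔ (∀ i, 0 ≤ w ⬝ᵥ toReal (v i)) ∧
      ∃ y ∈ t • newtonPolyhedron 𝔞, ∀ i, (w + y) ⬝ᵥ toReal (v i) < coCoeff v D i := by
  rw [triplePolytope, Set.mem_inter_iff, SetLike.mem_coe, mem_dualCone_iff hv.hull_eq, and_comm]
  refine and_congr_right fun h0 => ?_
  constructor
  · rintro ⟨x, hx, y, hy, rfl⟩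
    refine ⟨y, hy, fun i => ?_⟩
    simpa [coCoeff] using (hx i).2
  · rintro ⟨y, hy, h⟩
    refine ⟨w + y, fun i => ⟨?_, h i⟩, y, hy, by simp⟩
    rw [add_dotProduct]
    exact add_nonneg (h0 i) (hf.smul_newtonPolyhedron_nonneg ht hy i)

/-- Replacing the strict inequalities in the definition of the polytope by weak ones does not change
its volume. -/
theorem FacetPresentation.volume_triplePolytope (hf : FacetPresentation σ v)
    (hv : IsPrimitiveGenerators σ v)
    (D : QDivisor (ToricRing k σ)) (𝔞 : Ideal (ToricRing k σ)) {t : ℝ} (ht : 0 ≤ t) :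
    volume (triplePolytope v D 𝔞 t) =
      volume (translatedPolytope v (coCoeff v D) (t • newtonPolyhedron 𝔞)) := by
  refine le_antisymm (measure_mono fun w hw => ?_) ?_
  · obtain ⟨h0, y, hy, h⟩ := (hf.mem_triplePolytope_iff hv ht).1 hw
    exact ⟨h0, y, hy, fun i => (h i).le⟩
  · have hc : Convex ℝ (translatedPolytope v (coCoeff v D) (t • newtonPolyhedron 𝔞)) :=
      convex_translatedPolytope _ ((convex_convexHull ℝ _).smul t)
    rw [← measure_interior_of_null_frontier (hc.addHaar_frontier volume)]
    refine measure_mono fun w hw => ?_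
    obtain ⟨s, hs⟩ := hf.exists_interior
    have hs' : ∀ i, 0 < toReal s ⬝ᵥ toReal (v i) := fun i => by
      rw [toReal_dotProduct]
      exact_mod_cast hs i
    -- An interior point can be pushed slightly along `s` without leaving the closed version. As `s`
    -- pairs strictly positively with each `v i`, the inequalities at the original point are strict.
    have hcont : Tendsto (fun ε : ℝ => w + ε • toReal s) (𝓝[>] 0) (𝓝 w) := by
      have : Continuous fun ε : ℝ => w + ε • toReal s := by fun_prop
      simpa using (this.tendsto 0).mono_left nhdsWithin_le_nhds
    obtain ⟨ε, hε, hpos⟩ := ((hcont.eventually (mem_interior_iff_mem_nhds.1 hw)).and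
      self_mem_nhdsWithin).exists
    obtain ⟨-, y, hy, h⟩ := hε
    refine (hf.mem_triplePolytope_iff hv ht).2 ⟨(interior_subset hw).1, y, hy, fun i => ?_⟩
    refine lt_of_lt_of_le ?_ (h i)
    rw [add_dotProduct, add_dotProduct, add_dotProduct, smul_dotProduct]
    have := mul_pos hpos (hs' i)
    simp only [smul_eq_mul]
    linarith

theorem FacetPresentation.isBounded_newton_translatedPolytope (hf : FacetPresentation σ v)
    (hv : ∀ x : Fin n → ℝ, (∀ i, x ⬝ᵥ toReal (v i) = 0) → x = 0)
    (D : QDivisor (ToricRing k σ)) (𝔞 : Ideal (ToricRing k σ)) {t : ℝ} (ht : 0 ≤ t) :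
    Bornology.IsBounded
      (translatedPolytope v (coCoeff v D) (t • newtonPolyhedron 𝔞)) :=
  isBounded_translatedPolytope hv _ fun _ hy i => hf.smul_newtonPolyhedron_nonneg ht hy i

/-- An approximation of the polytope from inside. -/
def innerPolytope (v : Fin r → Fin n → ℤ) (D : QDivisor (ToricRing k σ))
    (𝔞 : Ideal (ToricRing k σ)) (t : ℝ)
    (x : Finset {u : charMonoid σ // monomial k u ∈ 𝔞} × ℕ) : Set (Fin n → ℝ) :=
  translatedPolytope v (fun i => coCoeff v D i - 1 / ((x.2 : ℝ) + 1))
    (t • convexHull ℝ (realExponent 𝔞 '' (x.1 : Set {u : charMonoid σ // monomial k u ∈ 𝔞})))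

theorem convex_innerPolytope (D : QDivisor (ToricRing k σ)) (𝔞 : Ideal (ToricRing k σ)) (t : ℝ)
    (x : Finset {u : charMonoid σ // monomial k u ∈ 𝔞} × ℕ) :
    Convex ℝ (innerPolytope v D 𝔞 t x) :=
  convex_translatedPolytope _ ((convex_convexHull ℝ _).smul t)

theorem monotone_innerPolytope (D : QDivisor (ToricRing k σ)) (𝔞 : Ideal (ToricRing k σ)) (t : ℝ) :
    Monotone (innerPolytope v D 𝔞 t) := by
  intro x y hxy
  refine translatedPolytope_mono (fun i => ?_)
    (Set.smul_set_mono (convexHull_mono (Set.image_mono (Finset.coe_subset.2 hxy.1))))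
  have : (x.2 : ℝ) ≤ y.2 := Nat.cast_le.2 hxy.2
  have := one_div_le_one_div_of_le (by positivity : (0 : ℝ) < (x.2 : ℝ) + 1)
    (by linarith : (x.2 : ℝ) + 1 ≤ y.2 + 1)
  linarith

theorem innerPolytope_subset (D : QDivisor (ToricRing k σ)) (𝔞 : Ideal (ToricRing k σ)) (t : ℝ)
    (x : Finset {u : charMonoid σ // monomial k u ∈ 𝔞} × ℕ) :
    innerPolytope v D 𝔞 t x ⊆
      translatedPolytope v (coCoeff v D) (t • newtonPolyhedron 𝔞) := by
  refine translatedPolytope_mono (fun i => sub_le_self _ (by positivity)) ?_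
  rw [newtonPolyhedron_eq]
  exact Set.smul_set_mono (convexHull_mono (Set.image_subset_range _ _))

/-- A point of the hull involves finitely many exponents, and finitely many strict inequalities
leave a uniform margin. -/
theorem FacetPresentation.triplePolytope_subset_iUnion (hf : FacetPresentation σ v)
    (hv : IsPrimitiveGenerators σ v)
    (D : QDivisor (ToricRing k σ)) (𝔞 : Ideal (ToricRing k σ)) {t : ℝ} (ht : 0 ≤ t) :
    triplePolytope v D 𝔞 t ⊆ ⋃ x, innerPolytope v D 𝔞 t x := by
  classical
  intro w hw
  obtain ⟨h0, _, ⟨y, hy, rfl⟩, h⟩ := (hf.mem_triplePolytope_iff hv ht).1 hw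
  rw [newtonPolyhedron_eq, convexHull_eq_union_convexHull_finite_subsets] at hy
  simp only [Set.mem_iUnion] at hy
  obtain ⟨F, hF, hy⟩ := hy
  rw [← Set.image_univ, Finset.subset_set_image_iff] at hF
  obtain ⟨G, -, rfl⟩ := hF
  have hj : ∀ i, ∀ᶠ j : ℕ in atTop,
      1 / ((j : ℝ) + 1) < coCoeff v D i - (w + t • y) ⬝ᵥ toReal (v i) := fun i =>
    tendsto_one_div_add_atTop_nhds_zero_nat.eventually_lt_const (sub_pos.2 (h i))
  obtain ⟨j, hj⟩ := (eventually_all.2 hj).exists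
  refine Set.mem_iUnion.2 ⟨(G, j), h0, t • y, Set.smul_mem_smul_set (by simpa using hy),
    fun i => ?_⟩
  have := hj i
  simp only
  linarith

end Polytope

/-! ### Comparison of splitting exponents with lattice points. -/

section Counting

open MeasureTheory Filter Topology

variable {k : Type*} [Field k] {n r : ℕ} {σ : PointedCone ℝ (Fin n → ℝ)} {v : Fin r → Fin n → ℤ}

theorem monomial_sum_nsmul_mem_pow {ι : Type*} {𝔞 : Ideal (ToricRing k σ)} (G : Finset ι)
    (u : ι → charMonoid σ) (hu : ∀ g ∈ G, monomial k (u g) ∈ 𝔞) (c : ι → ℕ) {N : ℕ}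
    (hN : N ≤ ∑ g ∈ G, c g) : monomial k (∑ g ∈ G, c g • u g) ∈ 𝔞 ^ N := by
  refine Ideal.pow_le_pow_right hN ?_
  rw [monomial_sum, ← Finset.prod_pow_eq_pow_sum]
  refine Ideal.prod_mem_prod fun g hg => ?_
  rw [monomial_nsmul]
  exact Ideal.pow_mem_pow (hu g hg) _

/-- A point of the convex hull of finitely many exponents of `𝔞` is approximated by exponents of
powers of `𝔞`. -/
theorem FacetPresentation.exists_monomial_mem_pow (hf : FacetPresentation σ v)
    {𝔞 : Ideal (ToricRing k σ)} (G : Finset {u : charMonoid σ // monomial k u ∈ 𝔞})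
    {y : Fin n → ℝ} (hy : y ∈ convexHull ℝ (realExponent 𝔞 '' G)) (N : ℕ) :
    ∃ a : charMonoid σ, monomial k a ∈ 𝔞 ^ N ∧ ∀ i,
      toReal (a : Fin n → ℤ) ⬝ᵥ toReal (v i) ≤
        N * (y ⬝ᵥ toReal (v i)) + ∑ g ∈ G, realExponent 𝔞 g ⬝ᵥ toReal (v i) := by
  classical
  rw [← Finset.coe_image, Finset.mem_convexHull'] at hy
  obtain ⟨c, hc0, hc1, rfl⟩ := hy
  have hinj : Function.Injective (realExponent 𝔞) := fun a b h =>
    Subtype.ext (Subtype.ext (toReal_injective h))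
  rw [Finset.sum_image hinj.injOn] at hc1 ⊢
  have hc0' : ∀ g ∈ G, 0 ≤ c (realExponent 𝔞 g) := fun g hg =>
    hc0 _ (Finset.mem_image_of_mem _ hg)
  -- Rounding every weight up keeps at least `N` factors and adds less than one extra copy of each
  -- `g`, whence the error term independent of `N`.
  refine ⟨∑ g ∈ G, ⌈N * c (realExponent 𝔞 g)⌉₊ • (g : charMonoid σ),
    monomial_sum_nsmul_mem_pow G _ (fun g _ => g.2) _ ?_, fun i => ?_⟩
  · have h : (N : ℝ) ≤ ∑ g ∈ G, (⌈N * c (realExponent 𝔞 g)⌉₊ : ℝ) :=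
      calc (N : ℝ) = ∑ g ∈ G, N * c (realExponent 𝔞 g) := by
            rw [← Finset.mul_sum, hc1, mul_one]
        _ ≤ _ := Finset.sum_le_sum fun g _ => Nat.le_ceil _
    exact_mod_cast h
  · have h1 : toReal ((∑ g ∈ G, ⌈N * c (realExponent 𝔞 g)⌉₊ • (g : charMonoid σ) :
        charMonoid σ) : Fin n → ℤ) =
          ∑ g ∈ G, (⌈N * c (realExponent 𝔞 g)⌉₊ : ℝ) • realExponent 𝔞 g := by
      ext l
      simp [toReal, realExponent]
    rw [h1, sum_dotProduct, sum_dotProduct, Finset.mul_sum, ← Finset.sum_add_distrib]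
    refine Finset.sum_le_sum fun g hg => ?_
    rw [smul_dotProduct, smul_dotProduct, smul_eq_mul, smul_eq_mul]
    have h2 := Nat.ceil_lt_add_one (mul_nonneg (Nat.cast_nonneg (α := ℝ) N) (hc0' g hg))
    have h3 : 0 ≤ realExponent 𝔞 g ⬝ᵥ toReal (v i) := hf.toReal_dotProduct_nonneg _ i
    nlinarith

theorem FacetPresentation.eventually_latticePoints_innerPolytope (hf : FacetPresentation σ v)
    (p : ℕ) [Fact p.Prime]
    (D : QDivisor (ToricRing k σ)) (𝔞 : Ideal (ToricRing k σ)) {t : ℝ} (ht : 0 ≤ t)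
    (x : Finset {u : charMonoid σ // monomial k u ∈ 𝔞} × ℕ) :
    ∀ᶠ e : ℕ in atTop, latticePoints (innerPolytope v D 𝔞 t x) ((p : ℝ) ^ e - 1) ⊆
      Subtype.val '' splittingExponents p v D 𝔞 t e := by
  have hp : (1 : ℝ) < p := by exact_mod_cast (Fact.out : p.Prime).one_lt
  have hlim : Tendsto (fun e : ℕ => (p : ℝ) ^ e - 1) atTop atTop :=
    tendsto_atTop_add_const_right _ _ (tendsto_pow_atTop_atTop_of_one_lt hp)
  have hδ : (0 : ℝ) < 1 / ((x.2 : ℝ) + 1) := by positivity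
  -- One copy of the sum absorbs the rounding of the weights, the other the rounding of `m * t` to a
  -- natural number. Both errors are bounded, while the margin grows with `m`.
  have hC : ∀ i, ∀ᶠ e : ℕ in atTop,
      2 * ∑ g ∈ x.1, realExponent 𝔞 g ⬝ᵥ toReal (v i) ≤
        ((p : ℝ) ^ e - 1) * (1 / ((x.2 : ℝ) + 1)) := fun i =>
    (hlim.atTop_mul_const hδ).eventually_ge_atTop _
  filter_upwards [eventually_all.2 hC, hlim.eventually_gt_atTop 0] with e he hm u hu
  set m : ℝ := (p : ℝ) ^ e - 1 with hmdef
  obtain ⟨h0, _, ⟨y, hy, rfl⟩, h⟩ := hu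
  have h0' : ∀ i, 0 ≤ u ⬝ᵥ v i := fun i => by
    have := h0 i
    rw [smul_dotProduct, toReal_dotProduct, smul_eq_mul] at this
    exact_mod_cast (mul_nonneg_iff_of_pos_left (inv_pos.2 hm)).1 this
  obtain ⟨a, ha, hai⟩ := hf.exists_monomial_mem_pow x.1 hy ⌈m * t⌉₊
  refine ⟨⟨u, (hf.mem_charMonoid_iff u).2 h0'⟩, ⟨a, ha, fun i => ?_⟩, rfl⟩
  rw [lt_sub_roundUp_iff, ← hmdef, AddSubmonoid.coe_add, add_dotProduct, Int.cast_add,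
    ← toReal_dotProduct, ← toReal_dotProduct]
  have hN := Nat.ceil_lt_add_one (mul_nonneg hm.le ht)
  have hy0 : 0 ≤ y ⬝ᵥ toReal (v i) := hf.newtonPolyhedron_nonneg (𝔞 := 𝔞) (by
    rw [newtonPolyhedron_eq]
    exact convexHull_mono (Set.image_subset_range _ _) hy) i
  have hyC : y ⬝ᵥ toReal (v i) ≤ ∑ g ∈ x.1, realExponent 𝔞 g ⬝ᵥ toReal (v i) := by
    have hc : Convex ℝ {y : Fin n → ℝ |
        y ⬝ᵥ toReal (v i) ≤ ∑ g ∈ x.1, realExponent 𝔞 g ⬝ᵥ toReal (v i)} :=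
      (convex_Iic _).linear_preimage ((dotProductBilin ℝ ℝ).flip (toReal (v i)))
    refine convexHull_min ?_ hc hy
    rintro _ ⟨g, hg, rfl⟩
    exact Finset.single_le_sum (f := fun g => realExponent 𝔞 g ⬝ᵥ toReal (v i))
      (fun g _ => hf.toReal_dotProduct_nonneg _ i) hg
  have hi := h i
  rw [add_dotProduct, smul_dotProduct, smul_dotProduct, smul_eq_mul, smul_eq_mul] at hi
  have hi' := mul_le_mul_of_nonneg_left hi hm.le
  rw [mul_add, mul_inv_cancel_left₀ hm.ne', mul_sub] at hi'
  have hNy : (⌈m * t⌉₊ : ℝ) * (y ⬝ᵥ toReal (v i)) ≤ (m * t + 1) * (y ⬝ᵥ toReal (v i)) :=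
    mul_le_mul_of_nonneg_right hN.le hy0
  have := he i
  have := hai i
  change toReal u ⬝ᵥ toReal (v i) + _ ≤ _
  nlinarith

/-- A monomial of `𝔞 ^ N` is a multiple of a product of `N` generators, and `y` is the average of
their exponents. -/
theorem exists_mem_newtonPolyhedron {𝔞 : Ideal (ToricRing k σ)} (h𝔞 : IsMonomialIdeal 𝔞)
    (hf : FacetPresentation σ v) {N : ℕ} (hN : N ≠ 0) {a : charMonoid σ}
    (ha : monomial k a ∈ 𝔞 ^ N) :
    ∃ y ∈ newtonPolyhedron 𝔞, ∀ i,
      N * (y ⬝ᵥ toReal (v i)) ≤ toReal (a : Fin n → ℤ) ⬝ᵥ toReal (v i) := by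
  obtain ⟨T, hT⟩ := h𝔞
  rw [hT, span_monomial_pow, monomial_mem_span_iff] at ha
  obtain ⟨_, ⟨c, hc, rfl⟩, d, rfl⟩ := ha
  have hN' : (N : ℝ) ≠ 0 := Nat.cast_ne_zero.2 hN
  refine ⟨∑ l : Fin N, (N : ℝ)⁻¹ • toReal (c l : Fin n → ℤ), ?_, fun i => ?_⟩
  · refine (convex_convexHull ℝ _).sum_mem (fun _ _ => by positivity) (by simp [hN']) fun l _ => ?_
    refine subset_convexHull ℝ _ ⟨c l, ?_, rfl⟩
    rw [Set.mem_ofPred_eq, hT]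
    exact Ideal.subset_span ⟨c l, hc l, rfl⟩
  · have h1 : toReal ((d + ∑ l, c l : charMonoid σ) : Fin n → ℤ) =
        toReal (d : Fin n → ℤ) + ∑ l, toReal (c l : Fin n → ℤ) := by
      ext j
      simp [toReal]
    rw [h1, ← Finset.smul_sum, smul_dotProduct, smul_eq_mul, mul_inv_cancel_left₀ hN',
      add_dotProduct]
    exact le_add_of_nonneg_left (hf.toReal_dotProduct_nonneg d i)

theorem IsMonomialIdeal.nonempty_newtonPolyhedron {𝔞 : Ideal (ToricRing k σ)}
    (h𝔞 : IsMonomialIdeal 𝔞) (h : 𝔞 ≠ ⊥) : (newtonPolyhedron 𝔞).Nonempty := by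
  obtain ⟨T, rfl⟩ := h𝔞
  have hT : T.Nonempty := by
    rw [Set.nonempty_iff_ne_empty]
    rintro rfl
    simp at h
  obtain ⟨u, hu⟩ := hT
  exact ⟨_, subset_convexHull ℝ _ ⟨u, Ideal.subset_span ⟨u, hu, rfl⟩, rfl⟩⟩

theorem FacetPresentation.splittingExponents_subset (hf : FacetPresentation σ v)
    (p : ℕ) [Fact p.Prime] (D : QDivisor (ToricRing k σ)) {𝔞 : Ideal (ToricRing k σ)}
    (h𝔞 : IsMonomialIdeal 𝔞) {t : ℝ} (ht : 0 ≤ t) (h𝔞t : t = 0 → 𝔞 ≠ ⊥) {e : ℕ} (he : e ≠ 0) :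
    Subtype.val '' splittingExponents p v D 𝔞 t e ⊆
      latticePoints (translatedPolytope v (coCoeff v D) (t • newtonPolyhedron 𝔞))
        ((p : ℝ) ^ e - 1) := by
  have hp : (1 : ℝ) < p := by exact_mod_cast (Fact.out : p.Prime).one_lt
  have hm : 0 < (p : ℝ) ^ e - 1 := sub_pos.2 (one_lt_pow₀ hp he)
  rintro _ ⟨u, ⟨a, ha, hua⟩, rfl⟩
  set m : ℝ := (p : ℝ) ^ e - 1 with hmdef
  have key : ∃ y ∈ t • newtonPolyhedron 𝔞, ∀ i,
      m * (y ⬝ᵥ toReal (v i)) ≤ toReal (a : Fin n → ℤ) ⬝ᵥ toReal (v i) := by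
    -- Exponent zero forces `t = 0`. Then `𝔞 ^ 0` is the whole ring, whereas `0 • newtonPolyhedron
    -- 𝔞` would be empty for `𝔞 = 0`; this is where `h𝔞t` enters.
    by_cases hN : ⌈m * t⌉₊ = 0
    · have ht0 : t = 0 := le_antisymm
        (nonpos_of_mul_nonpos_right (Nat.ceil_eq_zero.1 hN) hm) ht
      obtain ⟨y, hy⟩ := h𝔞.nonempty_newtonPolyhedron (h𝔞t ht0)
      refine ⟨t • y, Set.smul_mem_smul_set hy, fun i => ?_⟩
      rw [ht0, zero_smul, zero_dotProduct, mul_zero]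
      exact hf.toReal_dotProduct_nonneg a i
    · obtain ⟨y, hy, h⟩ := exists_mem_newtonPolyhedron h𝔞 hf hN ha
      refine ⟨t • y, Set.smul_mem_smul_set hy, fun i => le_trans ?_ (h i)⟩
      rw [smul_dotProduct, smul_eq_mul, ← mul_assoc]
      exact mul_le_mul_of_nonneg_right (Nat.le_ceil _) (hf.newtonPolyhedron_nonneg hy i)
  obtain ⟨y, hy, h⟩ := key
  refine ⟨fun i => ?_, y, hy, fun i => ?_⟩
  · rw [smul_dotProduct]
    exact mul_nonneg (inv_nonneg.2 hm.le) (hf.toReal_dotProduct_nonneg u i)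
  · have h1 := lt_sub_roundUp_iff.1 (hua i)
    rw [← hmdef, AddSubmonoid.coe_add, add_dotProduct, Int.cast_add,
      ← toReal_dotProduct, ← toReal_dotProduct] at h1
    rw [add_dotProduct, smul_dotProduct, smul_eq_mul]
    refine le_of_mul_le_mul_left ?_ hm
    rw [mul_add, mul_inv_cancel_left₀ hm.ne']
    linarith [h i]

end Counting

/-! ### Passage to the limit. -/

section Limit

open MeasureTheory Filter Topology

variable {k : Type*} [Field k] {n r : ℕ} {σ : PointedCone ℝ (Fin n → ℝ)} {v : Fin r → Fin n → ℤ}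

/-- The hyperplane orthogonal to `x` contains `σ`, hence its span, hence `x` itself. -/
theorem IsPrimitiveGenerators.eq_zero_of_dotProduct_eq_zero (hv : IsPrimitiveGenerators σ v)
    (hσ : Submodule.span ℝ (σ : Set (Fin n → ℝ)) = ⊤) {x : Fin n → ℝ}
    (hx : ∀ i, x ⬝ᵥ toReal (v i) = 0) : x = 0 := by
  have h1 : σ ≤ PointedCone.hull ℝ {y | x ⬝ᵥ y = 0} := by
    rw [← hv.hull_eq]
    refine Submodule.span_mono ?_
    rintro _ ⟨i, rfl⟩
    exact hx i
  have h2 : (⊤ : Submodule ℝ (Fin n → ℝ)) ≤ LinearMap.ker (dotProductBilin ℝ ℝ x) := by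
    rw [← hσ, Submodule.span_le]
    intro y hy
    have hy' := h1 hy
    clear hy
    induction hy' using Submodule.span_induction with
    | mem y hy => exact hy
    | zero => exact zero_mem _
    | add a b _ _ ha hb => exact add_mem ha hb
    | smul c a _ ha => exact Submodule.smul_mem _ (c : ℝ) ha
  refine dotProduct_self_eq_zero.1 ?_
  exact h2 (Submodule.mem_top (x := x))

theorem splittingExponents_ncard_tendsto (hv : IsPrimitiveGenerators σ v)
    (hf : FacetPresentation σ v)
    (hσ : ∀ x : Fin n → ℝ, (∀ i, x ⬝ᵥ toReal (v i) = 0) → x = 0)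
    (p : ℕ) [Fact p.Prime] (D : QDivisor (ToricRing k σ)) {𝔞 : Ideal (ToricRing k σ)}
    (h𝔞 : IsMonomialIdeal 𝔞) {t : ℝ} (ht : 0 ≤ t) (h𝔞t : t = 0 → 𝔞 ≠ ⊥) :
    Tendsto (fun e : ℕ => ((splittingExponents p v D 𝔞 t e).ncard : ℝ) / ((p : ℝ) ^ e - 1) ^ n)
      atTop (𝓝 (volume.real (triplePolytope v D 𝔞 t))) := by
  have hp : 1 < p := (Fact.out : p.Prime).one_lt
  have hcast : ∀ e : ℕ, ((p ^ e - 1 : ℕ) : ℝ) = (p : ℝ) ^ e - 1 := fun e => by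
    rw [Nat.cast_sub (Nat.one_le_pow _ _ (by omega))]
    push_cast
    rfl
  have hm : Tendsto (fun e : ℕ => p ^ e - 1) atTop atTop :=
    (tendsto_sub_atTop_nat 1).comp (tendsto_pow_atTop_atTop_of_one_lt hp)
  have hpos : ∀ᶠ e : ℕ in atTop, 0 < (p : ℝ) ^ e - 1 := by
    filter_upwards [eventually_ne_atTop 0] with e he
    exact sub_pos.2 (one_lt_pow₀ (by exact_mod_cast hp) he)
  have hb := hf.isBounded_newton_translatedPolytope hσ D 𝔞 ht
  have hvol := hf.volume_triplePolytope hv D 𝔞 ht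
  have hfin : volume (triplePolytope v D 𝔞 t) ≠ ⊤ := by
    rw [hvol]
    exact hb.measure_lt_top.ne
  have hcount : ∀ {S : Set (Fin n → ℝ)}, Bornology.IsBounded S → Convex ℝ S →
      Tendsto (fun e : ℕ => ((latticePoints S ((p : ℝ) ^ e - 1)).ncard : ℝ) /
        ((p : ℝ) ^ e - 1) ^ n) atTop (𝓝 (volume.real S)) := by
    intro S hS hS'
    refine ((tendsto_ncard_latticePoints hS hS').comp hm).congr fun e => ?_
    simp only [Function.comp_apply, hcast]
  have hcard : ∀ e, (splittingExponents p v D 𝔞 t e).ncard =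
      (Subtype.val '' splittingExponents p v D 𝔞 t e).ncard := fun e =>
    (Set.ncard_image_of_injective _ Subtype.val_injective).symm
  refine tendsto_order.2 ⟨fun x hx => ?_, fun x hx => ?_⟩
  · rcases lt_or_ge x 0 with hx0 | hx0
    · filter_upwards [hpos] with e he
      exact hx0.trans_le (by positivity)
    · have h1 : ENNReal.ofReal x < volume (⋃ y, innerPolytope v D 𝔞 t y) :=
        ((ENNReal.ofReal_lt_iff_lt_toReal hx0 hfin).2 hx).trans_le
          (measure_mono (hf.triplePolytope_subset_iUnion hv D 𝔞 ht))
      have : Countable {u : charMonoid σ // monomial k u ∈ 𝔞} := inferInstance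
      -- Continuity from below for a countable directed union: a single inner polytope already has
      -- volume above `x`.
      rw [(monotone_innerPolytope D 𝔞 t).directed_le.measure_iUnion, lt_iSup_iff] at h1
      obtain ⟨y, hy⟩ := h1
      have hby := hb.subset (innerPolytope_subset D 𝔞 t y)
      have hy' := (ENNReal.ofReal_lt_iff_lt_toReal hx0 hby.measure_lt_top.ne).1 hy
      filter_upwards [(hcount hby (convex_innerPolytope D 𝔞 t y)).eventually_const_lt hy',
        hf.eventually_latticePoints_innerPolytope p D 𝔞 ht y, hpos, eventually_ne_atTop 0]
        with e h2 h3 h4 h5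
      refine h2.trans_le ?_
      rw [hcard]
      gcongr
      exact (latticePoints_finite hb h4.ne').subset (hf.splittingExponents_subset p D h𝔞 ht h𝔞t h5)
  · rw [measureReal_def, hvol, ← measureReal_def] at hx
    have hc : Convex ℝ (translatedPolytope v (coCoeff v D) (t • newtonPolyhedron 𝔞)) :=
      convex_translatedPolytope _ ((convex_convexHull ℝ _).smul t)
    filter_upwards [(hcount hb hc).eventually_lt_const hx, hpos, eventually_ne_atTop 0]
      with e h2 h4 h5
    refine lt_of_le_of_lt ?_ h2
    rw [hcard]
    gcongr
    · exact latticePoints_finite hb h4.ne'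
    · exact hf.splittingExponents_subset p D h𝔞 ht h𝔞t h5

/-- The two normalizations differ by the factor `(1 - p ^ (-e)) ^ n`, which tends to one. -/
theorem tendsto_div_pow_of_tendsto_div_sub_one_pow {p : ℕ} (hp : 1 < p) {c : ℕ → ℝ} {n : ℕ}
    {x : ℝ} (h : Tendsto (fun e : ℕ => c e / ((p : ℝ) ^ e - 1) ^ n) atTop (𝓝 x)) :
    Tendsto (fun e : ℕ => c e / (p : ℝ) ^ (e * n)) atTop (𝓝 x) := by
  have hp' : (1 : ℝ) < p := by exact_mod_cast hp
  have h1 : Tendsto (fun e : ℕ => (1 - ((p : ℝ)⁻¹) ^ e) ^ n) atTop (𝓝 1) := by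
    have := tendsto_pow_atTop_nhds_zero_of_lt_one (inv_nonneg.2 (by positivity : (0 : ℝ) ≤ p))
      (inv_lt_one_of_one_lt₀ hp')
    simpa using (this.const_sub 1).pow n
  have h2 := h.mul h1
  rw [mul_one] at h2
  refine h2.congr' ?_
  filter_upwards [eventually_ne_atTop 0] with e he
  have hm : 0 < (p : ℝ) ^ e - 1 := sub_pos.2 (one_lt_pow₀ hp' he)
  have hq : (p : ℝ) ^ e ≠ 0 := by positivity
  have e1 : 1 - ((p : ℝ)⁻¹) ^ e = ((p : ℝ) ^ e - 1) / (p : ℝ) ^ e := by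
    rw [inv_pow]
    field_simp
  rw [e1, div_pow, pow_mul]
  field_simp

end Limit

end FSignature

end
theorem mainTheorem3 (p : ℕ) [Fact p.Prime] (k : Type*) [Field k] [CharP k p] [PerfectField k]
    (n r : ℕ) (σ : PointedCone ℝ (Fin n → ℝ)) (v : Fin r → Fin n → ℤ)
    (hv : FSignature.IsPrimitiveGenerators σ v)
    (hσ_strongly_convex : ∀ x ∈ σ, x ≠ 0 → -x ∉ σ)
    (hσ_full : Submodule.span ℝ (σ : Set (Fin n → ℝ)) = ⊤)
    (D : FSignature.QDivisor (FSignature.ToricRing k σ))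
    (hD : D.IsEffective) (hD_inv : FSignature.IsTorusInvariant D)
    (𝔞 : Ideal (FSignature.ToricRing k σ)) (h𝔞 : FSignature.IsMonomialIdeal 𝔞)
    (t : ℝ) (ht : 0 ≤ t) (h𝔞t : t = 0 → 𝔞 ≠ ⊥) :
    FSignature.HasFSignature p (FSignature.maxIdeal k σ) D 𝔞 t
      (MeasureTheory.volume (FSignature.triplePolytope v D 𝔞 t)) := by
  have hf := hv.facetPresentation hσ_strongly_convex
  have hσ : ∀ x : Fin n → ℝ, (∀ i, x ⬝ᵥ FSignature.toReal (v i) = 0) → x = 0 :=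
    fun x hx => hv.eq_zero_of_dotProduct_eq_zero hσ_full hx
  have hσ' : ∀ u : Fin n → ℤ, (∀ i, u ⬝ᵥ v i = 0) → u = 0 := fun u hu =>
    FSignature.toReal_injective ((hσ _ fun i => by
      rw [FSignature.toReal_dotProduct, hu i, Int.cast_zero]).trans
        (funext fun _ => Int.cast_zero.symm))
  have hb := hf.isBounded_newton_translatedPolytope hσ D 𝔞 ht
  refine ⟨n, hf.ringKrullDim_toricRing hσ', ?_⟩
  have hlim := FSignature.tendsto_div_pow_of_tendsto_div_sub_one_pow (Fact.out : p.Prime).one_lt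
    (FSignature.splittingExponents_ncard_tendsto hv hf hσ p D h𝔞 ht h𝔞t)
  have hfin : MeasureTheory.volume (FSignature.triplePolytope v D 𝔞 t) ≠ ⊤ := by
    rw [hf.volume_triplePolytope hv D 𝔞 ht]
    exact hb.measure_lt_top.ne
  have hlim' := ENNReal.tendsto_ofReal hlim
  rw [MeasureTheory.measureReal_def, ENNReal.ofReal_toReal hfin] at hlim'
  refine hlim'.congr' ?_
  -- At `e = 0` the dilation factor `p ^ e - 1` is zero and the finiteness argument breaks down.
  filter_upwards [Filter.eventually_ne_atTop 0] with e he
  have hp : (1 : ℝ) < p := by exact_mod_cast (Fact.out : p.Prime).one_lt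
  have hfinite : (FSignature.splittingExponents p v D 𝔞 t e).Finite :=
    Set.Finite.of_finite_image ((FSignature.latticePoints_finite hb
      (sub_pos.2 (one_lt_pow₀ hp he)).ne').subset
        (hf.splittingExponents_subset p D h𝔞 ht h𝔞t he)) Subtype.val_injective.injOn
  have hlen : Module.length (FSignature.ToricRing k σ) (FSignature.ToricRing k σ ⧸
      FSignature.tripleIdeal p (FSignature.maxIdeal k σ) D 𝔞 t e) =
        ((FSignature.splittingExponents p v D 𝔞 t e).ncard : ℕ) := by
    rw [hf.tripleIdeal_eq p hσ' hD hD_inv h𝔞 t e]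
    have h := hf.length_quotient_avoidingIdeal (k := k) hσ' _ hfinite.toFinset
      (by
        rw [hfinite.coe_toFinset]
        exact hf.mem_splittingExponents_of_add p) rfl
    rw [Set.ncard_eq_toFinset_card _ hfinite, ← h]
    congr! 3 <;> exact hfinite.coe_toFinset.symm
  rw [hlen, ENNReal.ofReal_div_of_pos (by positivity), ENNReal.ofReal_natCast,
    ENNReal.ofReal_pow (by positivity), ENNReal.ofReal_natCast]
  simp
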